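/- Let $\Omega=(0,1]^d$ with Lebesgue measure $\mu$, and let $T$ be a finite partition tree of depth at most $K$: its root is $\Omega$, and each non-terminal node $A$ (a box) is cut along one coordinate into two half-open boxes, its children $A_l$ and $A_r$. Let $\mathcal N(T)$ be the set of non-terminal nodes. Consider the following Bayesian model given $T$. The latent states $\mathbf V=(V(A))_{A\in\mathcal N(T)}$, with values in $\{1,\dots,I\}$, follow a Markov process along $T$ (an initial distribution at the root and node-specific transition matrices from parent to child). Given $\mathbf V$, the vectors $(\theta_1(A),\dots,\theta_G(A))$ are independent over $A\in\mathcal N(T)$, and given $V(A)=i$ such a vector has one of the following priors, whose type and parameters may depend on $A$ and $i$: (A) independent beta variables; (B) $\theta_1(A)=\dots=\theta_G(A)$, one beta variable; (C) $\theta_1(A)=\dots=\theta_G(A)=c$ for a constant $c\in(0,1)$. Let $C_i(A)$ be the number of free parameters of this prior ($G$, $1$, $0$ respectively) and, for a configuration $\mathbf v=(\mathbf v(A))_{A\in\mathcal N(T)}$ of states, let $C(\mathbf v)=\sum_{A\in\mathcal N(T)}C_{\mathbf v(A)}(A)$. Given all the $\theta_g(A)$, the observations in group $g$ are i.i.d.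 from the distribution $Q_g$ on $\Omega$ with $Q_g(A_l\mid A)=\theta_g(A)=1-Q_g(A_r\mid A)$ for $A\in\mathcal N(T)$ and with uniform conditional distribution on each terminal node, independently over $g=1,\dots,G$. Let the data $\mathbf x_n$ in fact consist of independent observations, $n_g$ of them from a probability measure $P_g$ in group $g$, where $n=n_1+\dots+n_G$ and $n_g/n\to\zeta_g\in(0,1]$ as $n\to\infty$, and where $P_g\ll\mu$ has a density that is positive $\mu$-almost everywhere. A state $i$ is feasible at $A\in\mathcal N(T)$ if $(P_1(A_l\mid A),\dots,P_G(A_l\mid A))$ lies in the support of the prior of $(\theta_1(A),\dots,\theta_G(A))$ given $V(A)=i$. Let $\mathcal V_T$ be the set of configurations $\mathbf v$ such that $\mathbf v(A)$ is feasible at $A$ for every $A\in\mathcal N(T)$, and assume that $P(\mathbf V\in\mathcal V_T\mid T)>0$. Then, as $n\to\infty$, $$P\Big(\{\mathbf V\in\mathcal V_T\}\cap\Big\{C(\mathbf V)=\min_{\mathbf v\in\mathcal V_T,\ P(\mathbf V=\mathbf v\mid T)>0}C(\mathbf v)\Big\}\ \Big|\ T,\mathbf x_n\Big)\longrightarrow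 1\quad\text{in probability.}$$ -/

import Mathlib

open MeasureTheory ProbabilityTheory Filter

noncomputable section

namespace PolyaTree

/-- The sample space `(0,1]^d`, as a half-open box. -/
def unitBox (d : ℕ) : BoxIntegral.Box (Fin d) := ⟨fun _ => 0, fun _ => 1, fun _ => zero_lt_one⟩

/-- The cutting point along coordinate `j` of a box at relative location `s ∈ (0,1)`. -/
def cutPoint {d : ℕ} (B : BoxIntegral.Box (Fin d)) (j : Fin d) (s : Set.Ioo (0 : ℝ) 1) : ℝ :=
  B.lower j + s.1 * (B.upper j - B.lower j)

theorem lower_lt_cutPoint {d : ℕ} (B : BoxIntegral.Box (Fin d)) (j : Fin d)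
    (s : Set.Ioo (0 : ℝ) 1) : B.lower j < cutPoint B j s := by
  have h := B.lower_lt_upper j
  have := mul_pos s.2.1 (sub_pos.2 h)
  unfold cutPoint
  linarith

theorem cutPoint_lt_upper {d : ℕ} (B : BoxIntegral.Box (Fin d)) (j : Fin d)
    (s : Set.Ioo (0 : ℝ) 1) : cutPoint B j s < B.upper j := by
  have h := B.lower_lt_upper j
  have := mul_lt_mul_of_pos_right s.2.2 (sub_pos.2 h)
  unfold cutPoint
  linarith

/-- The left child of a box: the `j`-th side `(a_j, b_j]` becomes `(a_j, a_j + s (b_j - a_j)]`. -/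
def cutLeft {d : ℕ} (B : BoxIntegral.Box (Fin d)) (j : Fin d) (s : Set.Ioo (0 : ℝ) 1) :
    BoxIntegral.Box (Fin d) where
  lower := B.lower
  upper := Function.update B.upper j (cutPoint B j s)
  lower_lt_upper := fun i => by
    by_cases h : i = j
    · subst h
      simpa using lower_lt_cutPoint B i s
    · simp [h]

/-- The right child of a box: the `j`-th side `(a_j, b_j]` becomes `(a_j + s (b_j - a_j), b_j]`. -/
def cutRight {d : ℕ} (B : BoxIntegral.Box (Fin d)) (j : Fin d) (s : Set.Ioo (0 : ℝ) 1) :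
    BoxIntegral.Box (Fin d) where
  lower := Function.update B.lower j (cutPoint B j s)
  upper := B.upper
  lower_lt_upper := fun i => by
    by_cases h : i = j
    · subst h
      simpa using cutPoint_lt_upper B i s
    · simp [h]

/-- Finite dyadic partition trees: a node is either terminal, or it is cut along a dimension `j`
at a relative location `s ∈ (0,1)` into its left and right children. -/
inductive PTree (d : ℕ) : Type
  | leaf : PTree d
  | split (j : Fin d) (s : Set.Ioo (0 : ℝ) 1) (l r : PTree d) : PTree d

/-- The depth of a partition tree. -/
def PTree.depth {d : ℕ} : PTree d → ℕ
  | .leaf => 0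
  | .split _ _ l r => max l.depth r.depth + 1

/-- The trees with maximum depth `K`. -/
def PTree.ofMaxDepth (d K : ℕ) : Set (PTree d) := {T | T.depth ≤ K}

/-- The non-terminal nodes of a tree. -/
inductive Node {d : ℕ} : PTree d → Type
  | root {j : Fin d} {s : Set.Ioo (0 : ℝ) 1} {l r : PTree d} : Node (.split j s l r)
  | left {j : Fin d} {s : Set.Ioo (0 : ℝ) 1} {l r : PTree d} (A : Node l) : Node (.split j s l r)
  | right {j : Fin d} {s : Set.Ioo (0 : ℝ) 1} {l r : PTree d} (A : Node r) : Node (.split j s l r)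

/-- The non-terminal nodes of a split tree: the root, and those of the two subtrees. -/
def nodeSplitEquiv {d : ℕ} (j : Fin d) (s : Set.Ioo (0 : ℝ) 1) (l r : PTree d) :
    Option (Node l ⊕ Node r) ≃ Node (.split j s l r) where
  toFun
    | none => .root
    | some (.inl A) => .left A
    | some (.inr A) => .right A
  invFun
    | .root => none
    | .left A => some (.inl A)
    | .right A => some (.inr A)
  left_inv := by rintro (_ | _ | _) <;> rfl
  right_inv := by rintro (_ | _ | _) <;> rfl

instance instIsEmptyNodeLeaf {d : ℕ} : IsEmpty (Node (.leaf : PTree d)) := ⟨nofun⟩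

instance instFintypeNode {d : ℕ} : (T : PTree d) → Fintype (Node T)
  | .leaf => Fintype.ofIsEmpty
  | .split j s l r =>
    letI := instFintypeNode l
    letI := instFintypeNode r
    Fintype.ofEquiv _ (nodeSplitEquiv j s l r)

instance instDecidableEqNode {d : ℕ} (T : PTree d) : DecidableEq (Node T) := Classical.decEq _

/-- The parent of a node; the root has none. -/
def Node.parent {d : ℕ} : {T : PTree d} → Node T → Option (Node T)
  | _, .root => none
  | _, .left A => some (A.parent.elim .root .left)
  | _, .right A => some (A.parent.elim .root .right)

/-- The region `A` of a node, when the root of the tree is the box `B`. -/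
def Node.boxIn {d : ℕ} : {T : PTree d} → Node T → BoxIntegral.Box (Fin d) →
    BoxIntegral.Box (Fin d)
  | _, .root, B => B
  | .split j s _ _, .left A, B => A.boxIn (cutLeft B j s)
  | .split j s _ _, .right A, B => A.boxIn (cutRight B j s)

/-- The left child `A_l` of a node, when the root of the tree is the box `B`. -/
def Node.leftBoxIn {d : ℕ} : {T : PTree d} → Node T → BoxIntegral.Box (Fin d) →
    BoxIntegral.Box (Fin d)
  | .split j s _ _, .root, B => cutLeft B j s
  | .split j s _ _, .left A, B => A.leftBoxIn (cutLeft B j s)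
  | .split j s _ _, .right A, B => A.leftBoxIn (cutRight B j s)

/-- The subset `A` of `(0,1]^d` represented by a node. -/
def Node.region {d : ℕ} {T : PTree d} (A : Node T) : Set (Fin d → ℝ) :=
  (A.boxIn (unitBox d) : Set (Fin d → ℝ))

/-- The left child `A_l` of a node, as a subset of `(0,1]^d`. -/
def Node.leftRegion {d : ℕ} {T : PTree d} (A : Node T) : Set (Fin d → ℝ) :=
  (A.leftBoxIn (unitBox d) : Set (Fin d → ℝ))

/-- The density with respect to Lebesgue measure of the measure `Q` on the box `B` with
`Q(A_l ∣ A) = θ(A)` and `Q(A_r ∣ A) = 1 - θ(A)` at every non-terminal node `A`, and with uniform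
conditional distribution on every terminal node. -/
def densityIn {d : ℕ} : (T : PTree d) → BoxIntegral.Box (Fin d) → (Node T → ℝ) →
    (Fin d → ℝ) → ℝ
  | .leaf, B, _, x =>
    (B : Set (Fin d → ℝ)).indicator (fun _ => 1 / volume.real (B : Set (Fin d → ℝ))) x
  | .split j s l r, B, θ, x =>
    θ .root * densityIn l (cutLeft B j s) (fun A => θ (.left A)) x
      + (1 - θ .root) * densityIn r (cutRight B j s) (fun A => θ (.right A)) x

/-- The density on `(0,1]^d` of the measure `Q` determined by a tree and by the conditional
probabilities `θ(A) = Q(A_l ∣ A)`. -/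
def density {d : ℕ} (T : PTree d) (θ : Node T → ℝ) (x : Fin d → ℝ) : ℝ :=
  densityIn T (unitBox d) θ x

/-- The admitted priors of `(θ_1(A), …, θ_G(A))` at one node, given its state: independent beta
variables, one common beta variable, or a common constant in `(0,1)`. -/
inductive NodePrior (G : ℕ) : Type
  | indep (a b : Fin G → ℝ) (ha : ∀ g, 0 < a g) (hb : ∀ g, 0 < b g) : NodePrior G
  | tied (a b : ℝ) (ha : 0 < a) (hb : 0 < b) : NodePrior G
  | const (c : ℝ) (hc : c ∈ Set.Ioo (0 : ℝ) 1) : NodePrior G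

/-- The law of `(θ_1(A), …, θ_G(A))`. -/
def NodePrior.law {G : ℕ} : NodePrior G → Measure (Fin G → ℝ)
  | .indep a b _ _ => Measure.pi fun g => betaMeasure (a g) (b g)
  | .tied a b _ _ => (betaMeasure a b).map fun t _ => t
  | .const c _ => Measure.dirac fun _ => c

/-- The number of free parameters. -/
def NodePrior.numParams {G : ℕ} : NodePrior G → ℕ
  | .indep _ _ _ _ => G
  | .tied _ _ _ _ => 1
  | .const _ _ => 0

/-- The prior given the tree `T`, for `G` groups and states in `Fin I`: the initial distribution of
the state of the root, the node-specific transition matrices `ξ(A)` of the states from parent to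
child (the one at the root is not used), and the priors of `(θ_g(A))_g` given `V(A) = i`. -/
structure Model {d : ℕ} (T : PTree d) (G I : ℕ) where
  init : stdSimplex ℝ (Fin I)
  trans : Node T → Fin I → stdSimplex ℝ (Fin I)
  prior : Node T → Fin I → NodePrior G

namespace Model

variable {d G I : ℕ} {T : PTree d} (M : Model T G I)

/-- The prior probability `P(𝐕 = v ∣ T)` of a configuration of the states under the Markov process
along the tree. -/
def stateProb (v : Node T → Fin I) : ℝ :=
  ∏ A : Node T, match A.parent with
    | none => M.init.1 (v A)
    | some p => (M.trans A (v p)).1 (v A)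

/-- The prior probability `P(𝐕 ∈ S ∣ T)`. -/
def statePriorProb (S : Set (Node T → Fin I)) : ℝ :=
  ∑ v : Node T → Fin I, S.indicator M.stateProb v

/-- The law of all `θ_g(A)` given the states: independent over the nodes. -/
def thetaLaw (v : Node T → Fin I) : Measure (Node T → Fin G → ℝ) :=
  Measure.pi fun A => (M.prior A (v A)).law

/-- The likelihood `p(x ∣ T, v)` of `m g` observations `x g 0, …, x g (m g - 1)` in each group `g`,
which are i.i.d. from `Q_g` given the `θ`'s; the `θ`'s are integrated out. -/
def likelihood (m : Fin G → ℕ) (x : Fin G → ℕ → Fin d → ℝ) (v : Node T → Fin I) : ℝ :=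
  ∫ θ : Node T → Fin G → ℝ,
    ∏ g : Fin G, ∏ i ∈ Finset.range (m g), density T (fun A => θ A g) (x g i) ∂(M.thetaLaw v)

/-- The conditional posterior probability `P(𝐕 ∈ S ∣ T, x)`, by Bayes' formula. -/
def statePosterior (m : Fin G → ℕ) (x : Fin G → ℕ → Fin d → ℝ) (S : Set (Node T → Fin I)) : ℝ :=
  (∑ v : Node T → Fin I, S.indicator (fun w => M.stateProb w * M.likelihood m x w) v) /
    ∑ v : Node T → Fin I, M.stateProb v * M.likelihood m x v

/-- The feasible states `τ(A ∣ T)` at a node: the true conditional probabilities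
`(P_1(A_l ∣ A), …, P_G(A_l ∣ A))` lie in the support of the prior given the state. -/
def feasibleStates (P : Fin G → Measure (Fin d → ℝ)) (A : Node T) : Set (Fin I) :=
  {i | (fun g => (ProbabilityTheory.cond (P g) A.region).real A.leftRegion) ∈
    (M.prior A i).law.support}

/-- The set `𝒱_T` of the configurations that are feasible at every non-terminal node. -/
def feasible (P : Fin G → Measure (Fin d → ℝ)) : Set (Node T → Fin I) :=
  {v | ∀ A, v A ∈ M.feasibleStates P A}

/-- The possible realizations of the states, i.e. those of positive prior probability. -/
def possible : Set (Node T → Fin I) := {v | 0 < M.stateProb v}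

/-- The complexity `C(v)`: the total number of free parameters. -/
def complexity (v : Node T → Fin I) : ℕ := ∑ A : Node T, (M.prior A (v A)).numParams

end Model

end PolyaTree

end

noncomputable section

namespace PolyaTree

/-! The argument is a Laplace (BIC-type) comparison of marginal likelihoods. An observation follows
a single branch of the tree, so its density is a constant times a product over nodes of `θ` or `1 -
θ`. The priors are independent over the nodes given the states, so the likelihood of a configuration
is a product of one-node marginals, up to a factor common to all configurations
(`Model.exists_likelihood_eq_mul_prod`). Dividing by the likelihood of the true conditional
probabilities `τ` turns these marginals into `NodePrior.marginalRatio`.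

Put `s = √n`, and suppose that all node counts are within `O(s)` of their predictions. The
likelihood ratio at a node is then at most a constant times a Gaussian in `s * (θ - τ)`, and it is
bounded below on a ball of radius of order `1 / s` about `τ`. If `τ` lies in the support of the
prior, the marginal is therefore of the order of the prior mass of such a ball, `s ^ (-numParams)`
(`marginalRatio_le`, `le_marginalRatio`). If it does not, the prior stays away from `τ` and the
marginal is smaller than any power of `1 / s` (`marginalRatio_le_of_notMem_support`).

Let `q` be the least complexity of a feasible possible configuration. One configuration has weight
at least of order `s ^ (-q)`, while every possible configuration outside the target set has weight
`O(s ^ (-(q + 1)))`, because complexities are integers. The posterior mass of the complement is thus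
`O(1 / s)` (`Model.exists_dist_statePosterior_le`), and Chebyshev's inequality makes the counts
typical with probability as close to one as desired. -/

/-! ### Quadratic bounds for the Bernoulli likelihood ratio. -/

/-- The likelihood ratio of the success probability `θ` against `t`, after `k` successes and `r`
failures. -/
def bernoulliRatio (t : ℝ) (k r : ℕ) (θ : ℝ) : ℝ := (θ / t) ^ k * ((1 - θ) / (1 - t)) ^ r

/-- The counts of successes and failures among at most `s ^ 2` trials, and at least `c * s ^ 2`
trials, are within `M * s` of what the success probability `t` predicts. -/
structure TypicalCounts (t c M s : ℝ) (k r : ℕ) : Prop where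
  abs_sub_le : |(k : ℝ) - (k + r) * t| ≤ M * s
  le_add : c * s ^ 2 ≤ k + r
  add_le : (k + r : ℝ) ≤ s ^ 2

/-- With `θ = a ^ 2` and `t = b ^ 2`, squaring `a / b ≤ exp (a / b - 1)` loses `(a - b) ^ 2 / b ^ 2`
against the linear term. This Hellinger-type gap dominates `(θ - t) ^ 2 / 4` because `a + b ≤ 2` and
`b ≤ 1`. -/
theorem div_le_exp_sub_sq {t θ : ℝ} (ht : t ∈ Set.Ioo (0 : ℝ) 1) (hθ : θ ∈ Set.Ioo (0 : ℝ) 1) :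
    θ / t ≤ Real.exp ((θ - t) / t - (θ - t) ^ 2 / 4) := by
  obtain ⟨a, ha, rfl⟩ : ∃ a, 0 < a ∧ θ = a ^ 2 :=
    ⟨√θ, Real.sqrt_pos.2 hθ.1, (Real.sq_sqrt hθ.1.le).symm⟩
  obtain ⟨b, hb, rfl⟩ : ∃ b, 0 < b ∧ t = b ^ 2 :=
    ⟨√t, Real.sqrt_pos.2 ht.1, (Real.sq_sqrt ht.1.le).symm⟩
  have ha1 : a ≤ 1 := by nlinarith [hθ.2]
  have hb1 : b ≤ 1 := by nlinarith [ht.2]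
  have h1 : a / b ≤ Real.exp (a / b - 1) := by
    have := Real.add_one_le_exp (a / b - 1); linarith
  have h2 : a ^ 2 / b ^ 2 ≤ Real.exp (2 * (a / b - 1)) := by
    rw [← div_pow, two_mul, Real.exp_add, ← sq]
    exact pow_le_pow_left₀ (by positivity) h1 2
  refine h2.trans (Real.exp_le_exp.2 ?_)
  have h3 : (a ^ 2 - b ^ 2) / b ^ 2 - 2 * (a / b - 1) = (a - b) ^ 2 / b ^ 2 := by
    field_simp; ring
  have h4 : (a ^ 2 - b ^ 2) ^ 2 / 4 ≤ (a - b) ^ 2 := by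
    have : (a + b) ^ 2 ≤ 4 := by nlinarith
    nlinarith [mul_le_mul_of_nonneg_left this (sq_nonneg (a - b))]
  have h5 : (a - b) ^ 2 ≤ (a - b) ^ 2 / b ^ 2 := by
    rw [le_div_iff₀ (by positivity)]
    nlinarith [sq_nonneg (a - b), ht.2]
  linarith

/-- This is `1 - 1 / u ≤ log u` at `u = θ / t`; the remainder has the sign of `2 * θ - t`, which is
where closeness to `t` is used. -/
theorem exp_sub_sq_le_div {t θ : ℝ} (ht : 0 < t) (h : |θ - t| ≤ t / 2) :
    Real.exp ((θ - t) / t - 2 * (θ - t) ^ 2 / t ^ 2) ≤ θ / t := by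
  have h' := abs_le.1 h
  have hθ : 0 < θ := by linarith
  have hu : 0 < θ / t := div_pos hθ ht
  rw [← Real.le_log_iff_exp_le hu]
  refine le_trans ?_ (Real.one_sub_inv_le_log_of_pos hu)
  rw [inv_div]
  have : 1 - t / θ - ((θ - t) / t - 2 * (θ - t) ^ 2 / t ^ 2)
      = (θ - t) ^ 2 * (2 * θ - t) / (θ * t ^ 2) := by
    field_simp; ring
  have : 0 ≤ (θ - t) ^ 2 * (2 * θ - t) / (θ * t ^ 2) := by
    apply div_nonneg (mul_nonneg (sq_nonneg _) (by linarith)) (by positivity)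
  linarith

theorem bernoulliRatio_pos {t θ : ℝ} (ht : t ∈ Set.Ioo (0 : ℝ) 1) (hθ : θ ∈ Set.Ioo (0 : ℝ) 1)
    (k r : ℕ) : 0 < bernoulliRatio t k r θ :=
  mul_pos (pow_pos (div_pos hθ.1 ht.1) _)
    (pow_pos (div_pos (sub_pos.2 hθ.2) (sub_pos.2 ht.2)) _)

@[fun_prop]
theorem continuous_bernoulliRatio (t : ℝ) (k r : ℕ) : Continuous (bernoulliRatio t k r) := by
  unfold bernoulliRatio; fun_prop

/-- The linear terms for successes and failures combine into the score `(k - (k + r) * t) / (t * (1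
- t))` times `θ - t`, which typicality bounds by `M' * s * |θ - t|`. The quadratic terms contribute
at most `-(c / 4) * s ^ 2 * (θ - t) ^ 2`. -/
theorem bernoulliRatio_le {t c M : ℝ} (ht : t ∈ Set.Ioo (0 : ℝ) 1) (hc : 0 < c) :
    ∃ K > 0, ∀ s > 0, ∀ k r, TypicalCounts t c M s k r → ∀ θ ∈ Set.Ioo (0 : ℝ) 1,
      bernoulliRatio t k r θ ≤ K * Real.exp (-(c / 8) * s ^ 2 * (θ - t) ^ 2) := by
  set M' := M / (t * (1 - t)) with hM'
  have ht1 : 0 < 1 - t := sub_pos.2 ht.2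
  have ht0 := ht.1
  refine ⟨Real.exp (2 * M' ^ 2 / c), Real.exp_pos _, fun s hs k r H θ hθ => ?_⟩
  have h1 := div_le_exp_sub_sq ht hθ
  have h2 := div_le_exp_sub_sq (t := 1 - t) (θ := 1 - θ) ⟨ht1, by linarith⟩
    ⟨sub_pos.2 hθ.2, by linarith [hθ.1]⟩
  have h3 : bernoulliRatio t k r θ ≤ Real.exp (k * ((θ - t) / t - (θ - t) ^ 2 / 4)) *
      Real.exp (r * ((1 - θ - (1 - t)) / (1 - t) - (1 - θ - (1 - t)) ^ 2 / 4)) := by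
    rw [Real.exp_nat_mul, Real.exp_nat_mul]
    have := hθ.1
    have := sub_pos.2 hθ.2
    exact mul_le_mul (pow_le_pow_left₀ (by positivity) h1 _)
      (pow_le_pow_left₀ (by positivity) h2 _) (by positivity) (by positivity)
  refine h3.trans ?_
  rw [← Real.exp_add, ← Real.exp_add]
  apply Real.exp_le_exp.2
  set h := θ - t with hh
  have e : (k : ℝ) * (h / t - h ^ 2 / 4) + r * ((1 - θ - (1 - t)) / (1 - t)
      - (1 - θ - (1 - t)) ^ 2 / 4) = (k - (k + r) * t) / (t * (1 - t)) * h - (k + r) * h ^ 2 / 4 := by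
    rw [show (1 - θ - (1 - t)) = -h by rw [hh]; ring]
    field_simp; ring
  rw [e]
  have a1 : (k - (k + r) * t) / (t * (1 - t)) * h ≤ M' * s * |h| := by
    refine (le_abs_self _).trans ?_
    rw [abs_mul, abs_div, abs_of_pos (mul_pos ht0 ht1)]
    refine mul_le_mul_of_nonneg_right ?_ (abs_nonneg _)
    rw [hM', div_mul_eq_mul_div]
    exact div_le_div_of_nonneg_right H.abs_sub_le (mul_pos ht0 ht1).le
  have a2 : c * s ^ 2 * h ^ 2 ≤ (k + r) * h ^ 2 :=
    mul_le_mul_of_nonneg_right H.le_add (sq_nonneg _)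
  -- Completing the square: half of the quadratic decay absorbs the linear term at the price of the
  -- constant `2 * M' ^ 2 / c`.
  have a3 : 2 * M' ^ 2 / c - M' * (s * |h|) + c / 8 * (s * |h|) ^ 2
      = c / 8 * (s * |h| - 4 * M' / c) ^ 2 := by
    field_simp; ring
  have a4 : 0 ≤ c / 8 * (s * |h| - 4 * M' / c) ^ 2 := by positivity
  have a5 : (s * |h|) ^ 2 = s ^ 2 * h ^ 2 := by rw [mul_pow, sq_abs]
  rw [a5] at a3
  nlinarith

/-- At distance `O(1 / s)` from `t` both the score term and the quadratic terms of the exponent are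
bounded, the latter because there are at most `s ^ 2` trials. -/
theorem le_bernoulliRatio {t c M : ℝ} (ht : t ∈ Set.Ioo (0 : ℝ) 1) :
    ∃ κ > 0, ∃ ρ > 0, ∀ s ≥ 1, ∀ k r, TypicalCounts t c M s k r → ∀ θ, |θ - t| ≤ ρ / s →
      θ ∈ Set.Ioo (0 : ℝ) 1 ∧ κ ≤ bernoulliRatio t k r θ := by
  have ht1 : 0 < 1 - t := sub_pos.2 ht.2
  have ht0 := ht.1
  set m := min t (1 - t) with hm
  have hm0 : 0 < m := lt_min ht0 ht1
  have hmt : m ≤ t := min_le_left _ _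
  have hmt1 : m ≤ 1 - t := min_le_right _ _
  set M' := M / (t * (1 - t)) with hM'
  -- The radius `m / 2` keeps `θ` away from `0` and `1`, meets the closeness condition of
  -- `exp_sub_sq_le_div` on both sides, and gives `s * |θ - t| ≤ 1`.
  refine ⟨Real.exp (-M' - 2 / m ^ 2), Real.exp_pos _, m / 2, by positivity,
    fun s hs k r H θ hθ => ?_⟩
  have hs0 : 0 < s := by linarith
  have hle : m / 2 / s ≤ m / 2 := div_le_self (by positivity) hs
  have hθ' : |θ - t| ≤ m / 2 := hθ.trans hle
  have hθa := abs_le.1 hθ'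
  refine ⟨⟨by linarith, by linarith⟩, ?_⟩
  have h1 := exp_sub_sq_le_div (t := t) (θ := θ) ht0 (hθ'.trans (by linarith))
  have h2 := exp_sub_sq_le_div (t := 1 - t) (θ := 1 - θ) ht1
    (by rw [show (1 - θ - (1 - t)) = -(θ - t) by ring, abs_neg]; linarith)
  have h3 : Real.exp (k * ((θ - t) / t - 2 * (θ - t) ^ 2 / t ^ 2)) *
      Real.exp (r * ((1 - θ - (1 - t)) / (1 - t) - 2 * (1 - θ - (1 - t)) ^ 2 / (1 - t) ^ 2)) ≤
      bernoulliRatio t k r θ := by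
    rw [Real.exp_nat_mul, Real.exp_nat_mul]
    have : 0 < θ := by linarith
    exact mul_le_mul (pow_le_pow_left₀ (by positivity) h1 _)
      (pow_le_pow_left₀ (by positivity) h2 _) (by positivity) (by positivity)
  refine le_trans ?_ h3
  rw [← Real.exp_add]
  apply Real.exp_le_exp.2
  set h := θ - t with hh
  have e : (k : ℝ) * (h / t - 2 * h ^ 2 / t ^ 2) + r * ((1 - θ - (1 - t)) / (1 - t)
      - 2 * (1 - θ - (1 - t)) ^ 2 / (1 - t) ^ 2) = (k - (k + r) * t) / (t * (1 - t)) * h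
        - (k * (2 * h ^ 2 / t ^ 2) + r * (2 * h ^ 2 / (1 - t) ^ 2)) := by
    rw [show (1 - θ - (1 - t)) = -h by rw [hh]; ring]
    field_simp; ring
  rw [e]
  have hsh : s * |h| ≤ 1 := by
    have : s * |h| ≤ m / 2 := by rwa [le_div_iff₀ hs0, mul_comm] at hθ
    linarith
  have a1 : -M' ≤ (k - (k + r) * t) / (t * (1 - t)) * h := by
    have hMs := (abs_nonneg _).trans H.abs_sub_le
    have hM0 : 0 ≤ M := nonneg_of_mul_nonneg_left hMs hs0
    have : |(k - (k + r) * t) / (t * (1 - t)) * h| ≤ M' := by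
      rw [abs_mul, abs_div, abs_of_pos (mul_pos ht0 ht1), hM', div_mul_eq_mul_div]
      refine div_le_div_of_nonneg_right ?_ (mul_pos ht0 ht1).le
      calc _ ≤ M * s * |h| := mul_le_mul_of_nonneg_right H.abs_sub_le (abs_nonneg _)
        _ = M * (s * |h|) := by ring
        _ ≤ M := mul_le_of_le_one_right hM0 hsh
    exact (abs_le.1 this).1
  have b1 : 2 * h ^ 2 / t ^ 2 ≤ 2 * h ^ 2 / m ^ 2 := by gcongr
  have b2 : 2 * h ^ 2 / (1 - t) ^ 2 ≤ 2 * h ^ 2 / m ^ 2 := by gcongr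
  have b3 : s ^ 2 * h ^ 2 ≤ 1 := by
    rw [← sq_abs h, ← mul_pow]; exact pow_le_one₀ (by positivity) hsh
  have b4 : (k * (2 * h ^ 2 / t ^ 2) + r * (2 * h ^ 2 / (1 - t) ^ 2)) ≤ 2 / m ^ 2 := by
    calc _ ≤ (k : ℝ) * (2 * h ^ 2 / m ^ 2) + r * (2 * h ^ 2 / m ^ 2) := by gcongr
      _ = (k + r) * h ^ 2 * (2 / m ^ 2) := by ring
      _ ≤ s ^ 2 * h ^ 2 * (2 / m ^ 2) := by
        have := H.add_le; gcongr
      _ ≤ 1 * (2 / m ^ 2) := by gcongr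
      _ = _ := one_mul _
  linarith

/-! ### Beta priors near and away from an interior point. -/

theorem ae_mem_Ioo_betaMeasure (a b : ℝ) : ∀ᵐ x ∂betaMeasure a b, x ∈ Set.Ioo (0 : ℝ) 1 := by
  have hm : Measurable (betaPDF a b) := (measurable_betaPDFReal a b).ennreal_ofReal
  rw [betaMeasure, ae_withDensity_iff hm]
  refine ae_of_all _ fun x hx => ⟨?_, ?_⟩
  · by_contra h
    exact hx (betaPDF_eq_zero_of_nonpos (not_lt.1 h))
  · by_contra h
    exact hx (betaPDF_eq_zero_of_one_le (not_lt.1 h))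

theorem continuousAt_betaPDFReal (a b : ℝ) {t : ℝ} (ht : t ∈ Set.Ioo (0 : ℝ) 1) :
    ContinuousAt (betaPDFReal a b) t := by
  have h : betaPDFReal a b =ᶠ[nhds t]
      fun x => (1 / beta a b) * x ^ (a - 1) * (1 - x) ^ (b - 1) := by
    filter_upwards [Ioo_mem_nhds ht.1 ht.2] with x hx
    rw [betaPDFReal, if_pos ⟨hx.1, hx.2⟩]
  refine ContinuousAt.congr ?_ h.symm
  refine ContinuousAt.mul (continuousAt_const.mul ?_) ?_
  · exact Real.continuousAt_rpow_const _ _ (Or.inl ht.1.ne')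
  · exact ContinuousAt.rpow_const (by fun_prop) (Or.inl (sub_pos.2 ht.2).ne')

theorem betaPDFReal_nonneg {a b : ℝ} (ha : 0 < a) (hb : 0 < b) (x : ℝ) :
    0 ≤ betaPDFReal a b x := by
  by_cases h : 0 < x ∧ x < 1
  · exact (betaPDFReal_pos h.1 h.2 ha hb).le
  · rw [betaPDFReal, if_neg h]

theorem exists_betaPDFReal_bounds {a b t : ℝ} (ha : 0 < a) (hb : 0 < b)
    (ht : t ∈ Set.Ioo (0 : ℝ) 1) :
    ∃ ρ > 0, ∃ l > 0, ∃ u > 0, ∀ x, |x - t| ≤ ρ → betaPDFReal a b x ∈ Set.Icc l u := by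
  have hp := betaPDFReal_pos ht.1 ht.2 ha hb
  have h := (continuousAt_betaPDFReal a b ht).eventually
    (Ioo_mem_nhds (half_lt_self hp) (lt_two_mul_self hp))
  obtain ⟨ρ, hρ, H⟩ := Metric.eventually_nhds_iff.1 h
  refine ⟨ρ / 2, by positivity, _, half_pos hp, _, mul_pos two_pos hp, fun x hx => ?_⟩
  have := H (y := x) (by rw [Real.dist_eq]; linarith)
  exact ⟨this.1.le, this.2.le⟩

theorem integrable_betaPDFReal {a b : ℝ} (ha : 0 < a) (hb : 0 < b) :
    Integrable (betaPDFReal a b) := by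
  refine ⟨(stronglyMeasurable_betaPDFReal a b).aestronglyMeasurable, ?_⟩
  rw [hasFiniteIntegral_iff_ofReal (ae_of_all _ (betaPDFReal_nonneg ha hb))]
  have := lintegral_betaPDF_eq_one ha hb
  unfold betaPDF at this
  rw [this]
  exact ENNReal.one_lt_top

theorem integral_betaPDFReal {a b : ℝ} (ha : 0 < a) (hb : 0 < b) :
    ∫ x, betaPDFReal a b x = 1 := by
  rw [integral_eq_lintegral_of_nonneg_ae (ae_of_all _ (betaPDFReal_nonneg ha hb))
    (stronglyMeasurable_betaPDFReal a b).aestronglyMeasurable]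
  have := lintegral_betaPDF_eq_one ha hb
  unfold betaPDF at this
  rw [this, ENNReal.toReal_one]

theorem integral_betaMeasure {a b : ℝ} (ha : 0 < a) (hb : 0 < b) (f : ℝ → ℝ) :
    ∫ x, f x ∂betaMeasure a b = ∫ x, betaPDFReal a b x * f x := by
  have hm : Measurable (betaPDF a b) := (measurable_betaPDFReal a b).ennreal_ofReal
  rw [betaMeasure, integral_withDensity_eq_integral_toReal_smul hm
    (ae_of_all _ fun x => ENNReal.ofReal_lt_top)]
  refine integral_congr_ae (ae_of_all _ fun x => ?_)
  simp only [betaPDF, smul_eq_mul]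
  rw [ENNReal.toReal_ofReal (betaPDFReal_nonneg ha hb x)]

/-- A single term of the exponential series suffices, with `s ^ q ≤ s ^ (2 * q)`. -/
theorem exp_neg_mul_sq_le {c : ℝ} (hc : 0 < c) (q : ℕ) :
    ∃ C > 0, ∀ s ≥ (1 : ℝ), Real.exp (-(c * s ^ 2)) ≤ C / s ^ q := by
  refine ⟨q.factorial / c ^ q, by positivity, fun s hs => ?_⟩
  have hs0 : 0 < s := by linarith
  have h := Real.pow_div_factorial_le_exp (x := c * s ^ 2) (by positivity) q
  rw [Real.exp_neg, inv_le_comm₀ (Real.exp_pos _) (by positivity)]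
  refine le_trans ?_ h
  rw [inv_div, div_div_eq_mul_div, mul_pow, mul_comm (s ^ q)]
  gcongr
  nlinarith

/-- The beta density may blow up at `0` and `1`, so it is bounded only near `t`, where the rescaled
Gaussian integral yields `1 / s`. Farther away the exponential is uniformly tiny and the density
integrates to one. -/
theorem integral_exp_neg_sq_betaMeasure_le {a b t c : ℝ} (ha : 0 < a) (hb : 0 < b)
    (ht : t ∈ Set.Ioo (0 : ℝ) 1) (hc : 0 < c) :
    ∃ C > 0, ∀ s ≥ (1 : ℝ),
      ∫ x, Real.exp (-c * s ^ 2 * (x - t) ^ 2) ∂betaMeasure a b ≤ C / s := by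
  obtain ⟨ρ, hρ, l, -, u, hu, H⟩ := exists_betaPDFReal_bounds ha hb ht
  obtain ⟨C, hC, hexp⟩ := exp_neg_mul_sq_le (c := c * ρ ^ 2) (by positivity) 1
  refine ⟨u * √(Real.pi / c) + C, by positivity, fun s hs => ?_⟩
  have hs0 : 0 < s := by linarith
  have hcs : 0 < c * s ^ 2 := by positivity
  have hgauss : ∫ x : ℝ, Real.exp (-c * s ^ 2 * (x - t) ^ 2) = √(Real.pi / c) / s := by
    rw [integral_sub_right_eq_self (fun x : ℝ => Real.exp (-c * s ^ 2 * x ^ 2)) t, neg_mul,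
      integral_gaussian, ← div_div, Real.sqrt_div (by positivity), Real.sqrt_sq hs0.le]
  have hint : Integrable fun x : ℝ => Real.exp (-c * s ^ 2 * (x - t) ^ 2) := by
    have := (integrable_exp_neg_mul_sq hcs).comp_sub_right t
    simpa only [neg_mul] using this
  rw [integral_betaMeasure ha hb]
  calc ∫ x, betaPDFReal a b x * Real.exp (-c * s ^ 2 * (x - t) ^ 2)
      ≤ ∫ x, (u * Real.exp (-c * s ^ 2 * (x - t) ^ 2)
          + Real.exp (-(c * ρ ^ 2 * s ^ 2)) * betaPDFReal a b x) := by
        refine integral_mono_of_nonneg (ae_of_all _ fun x => ?_)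
          ((hint.const_mul _).add ((integrable_betaPDFReal ha hb).const_mul _))
          (ae_of_all _ fun x => ?_)
        · exact mul_nonneg (betaPDFReal_nonneg ha hb x) (Real.exp_pos _).le
        · have h0 := betaPDFReal_nonneg ha hb x
          by_cases hx : |x - t| ≤ ρ
          · have h1 := mul_le_mul_of_nonneg_right (H x hx).2
              (Real.exp_pos (-c * s ^ 2 * (x - t) ^ 2)).le
            have h2 := mul_nonneg (Real.exp_pos (-(c * ρ ^ 2 * s ^ 2))).le h0
            simp only
            linarith
          · have h1 : Real.exp (-c * s ^ 2 * (x - t) ^ 2) ≤ Real.exp (-(c * ρ ^ 2 * s ^ 2)) := by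
              apply Real.exp_le_exp.2
              have : ρ ^ 2 ≤ (x - t) ^ 2 := by
                rw [← sq_abs (x - t)]
                exact pow_le_pow_left₀ hρ.le (not_le.1 hx).le 2
              nlinarith
            have h2 := mul_le_mul_of_nonneg_left h1 h0
            have h3 := mul_nonneg hu.le (Real.exp_pos (-c * s ^ 2 * (x - t) ^ 2)).le
            simp only
            linarith
    _ = u * (√(Real.pi / c) / s) + Real.exp (-(c * ρ ^ 2 * s ^ 2)) := by
        rw [integral_add (hint.const_mul _) ((integrable_betaPDFReal ha hb).const_mul _),
          integral_const_mul, integral_const_mul, hgauss, integral_betaPDFReal ha hb, mul_one]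
    _ ≤ u * (√(Real.pi / c) / s) + C / s := by
        have := hexp s hs
        rw [pow_one] at this
        linarith
    _ = _ := by ring

/-- The ball contains an interval of length `2 * m / s` on which the density is at least `l`; `s ≥
1` keeps that interval in the range of the local bounds. -/
theorem le_betaMeasure_real_closedBall {a b t ρ : ℝ} (ha : 0 < a) (hb : 0 < b)
    (ht : t ∈ Set.Ioo (0 : ℝ) 1) (hρ : 0 < ρ) :
    ∃ κ > 0, ∀ s ≥ (1 : ℝ), κ / s ≤ (betaMeasure a b).real {x | |x - t| ≤ ρ / s} := by
  have := isProbabilityMeasureBeta ha hb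
  obtain ⟨ρ', hρ', l, hl, u, -, H⟩ := exists_betaPDFReal_bounds ha hb ht
  set m := min ρ ρ'
  have hm : 0 < m := lt_min hρ hρ'
  refine ⟨l * (2 * m), by positivity, fun s hs => ?_⟩
  have hs0 : 0 < s := by linarith
  have hsub : Set.Icc (t - m / s) (t + m / s) ⊆ {x | |x - t| ≤ ρ / s} := by
    intro x hx
    have : m / s ≤ ρ / s := by gcongr; exact min_le_left _ _
    exact (abs_le.2 ⟨by linarith [hx.1], by linarith [hx.2]⟩ : |x - t| ≤ m / s).trans this
  refine le_trans ?_ (measureReal_mono hsub)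
  have h1 : ENNReal.ofReal (l * (2 * m) / s) ≤
      betaMeasure a b (Set.Icc (t - m / s) (t + m / s)) := by
    rw [betaMeasure, withDensity_apply _ measurableSet_Icc]
    calc ENNReal.ofReal (l * (2 * m) / s)
        = ∫⁻ x in Set.Icc (t - m / s) (t + m / s), ENNReal.ofReal l := by
          rw [setLIntegral_const, Real.volume_Icc, ← ENNReal.ofReal_mul hl.le]
          congr 1; ring
      _ ≤ _ := by
          refine setLIntegral_mono' measurableSet_Icc fun x hx => ?_
          refine ENNReal.ofReal_le_ofReal (H x (abs_le.2 ?_)).1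
          have : m / s ≤ ρ' := (div_le_self hm.le hs).trans (min_le_right _ _)
          exact ⟨by linarith [hx.1], by linarith [hx.2]⟩
  exact (ENNReal.ofReal_le_iff_le_toReal (measure_ne_top _ _)).1 h1

/-! ### The marginal likelihood at one node. -/

namespace NodePrior

variable {G : ℕ}

instance instIsProbabilityMeasureLaw : (p : NodePrior G) → IsProbabilityMeasure p.law
  | .indep a b ha hb => by
    have := fun g => isProbabilityMeasureBeta (ha g) (hb g)
    unfold law; infer_instance
  | .tied a b ha hb => by
    have := isProbabilityMeasureBeta ha hb
    unfold law; exact Measure.isProbabilityMeasure_map (by fun_prop)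
  | .const c hc => by unfold law; infer_instance

theorem ae_mem_Ioo (p : NodePrior G) : ∀ᵐ θ ∂p.law, ∀ g, θ g ∈ Set.Ioo (0 : ℝ) 1 := by
  have hmeas : MeasurableSet {θ : Fin G → ℝ | ∀ g, θ g ∈ Set.Ioo (0 : ℝ) 1} := by
    simp only [Set.ofPred_forall]
    exact MeasurableSet.iInter fun g => measurable_pi_apply g measurableSet_Ioo
  rcases p with ⟨a, b, ha, hb⟩ | ⟨a, b, ha, hb⟩ | ⟨c, hc⟩
  · have := fun g => isProbabilityMeasureBeta (ha g) (hb g)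
    rw [law, ae_all_iff]
    exact fun g => (Measure.quasiMeasurePreserving_eval _ g).ae (ae_mem_Ioo_betaMeasure _ _)
  · rw [law, ae_map_iff (by fun_prop) hmeas]
    filter_upwards [ae_mem_Ioo_betaMeasure a b] with x hx _ using hx
  · rw [law, ae_dirac_iff hmeas]
    exact fun _ => hc

/-- The diagonal is closed and carries all the mass, so it contains the support. -/
theorem eq_of_mem_support_tied {a b : ℝ} {ha : 0 < a} {hb : 0 < b} {τ : Fin G → ℝ}
    (h : τ ∈ (NodePrior.tied a b ha hb).law.support) (g g' : Fin G) : τ g = τ g' := by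
  have hclosed : IsClosed {θ : Fin G → ℝ | θ g = θ g'} :=
    isClosed_eq (continuous_apply g) (continuous_apply g')
  refine Measure.support_subset_of_isClosed hclosed ?_ h
  change ∀ᵐ θ : Fin G → ℝ ∂_, θ g = θ g'
  rw [law, ae_map_iff (by fun_prop) hclosed.measurableSet]
  exact ae_of_all _ fun _ => rfl

theorem eq_of_mem_support_const {c : ℝ} {hc : c ∈ Set.Ioo (0 : ℝ) 1} {τ : Fin G → ℝ}
    (h : τ ∈ (NodePrior.const c hc).law.support) : τ = fun _ => c := by
  refine Measure.support_subset_of_isClosed (isClosed_singleton (x := fun _ : Fin G => c)) ?_ h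
  rw [law, mem_ae_dirac_iff (measurableSet_singleton _)]
  rfl

/-- Each free parameter costs one factor `1 / s`. For a tied prior, membership in the support puts
`τ` on the diagonal, so the conditions reduce to one with the smallest radius; for a constant prior,
`τ` is the atom. -/
theorem le_law_real_pi_closedBall (p : NodePrior G) {τ ρ : Fin G → ℝ}
    (hτ : ∀ g, τ g ∈ Set.Ioo (0 : ℝ) 1) (hρ : ∀ g, 0 < ρ g) (hp : τ ∈ p.law.support) :
    ∃ κ > 0, ∀ s ≥ (1 : ℝ),
      κ / s ^ p.numParams ≤ p.law.real {θ | ∀ g, |θ g - τ g| ≤ ρ g / s} := by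
  rcases p with ⟨a, b, ha, hb⟩ | ⟨a, b, ha, hb⟩ | ⟨c, hc⟩
  · have := fun g => isProbabilityMeasureBeta (ha g) (hb g)
    choose κ hκ H using fun g => le_betaMeasure_real_closedBall (ha g) (hb g) (hτ g) (hρ g)
    refine ⟨∏ g, κ g, Finset.prod_pos fun g _ => hκ g, fun s hs => ?_⟩
    have hs0 : 0 < s := by linarith
    have e : {θ : Fin G → ℝ | ∀ g, |θ g - τ g| ≤ ρ g / s}
        = Set.univ.pi fun g => {x | |x - τ g| ≤ ρ g / s} := by
      ext; simp
    rw [law, numParams, e, measureReal_def, Measure.pi_pi, ENNReal.toReal_prod]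
    calc (∏ g, κ g) / s ^ G = ∏ g, κ g / s := by simp [Finset.prod_div_distrib]
      _ ≤ _ := Finset.prod_le_prod (fun g _ => (div_pos (hκ g) hs0).le) fun g _ => H g s hs
  · have := isProbabilityMeasureBeta ha hb
    rcases isEmpty_or_nonempty (Fin G) with hG | ⟨⟨g₀⟩⟩
    · refine ⟨1, one_pos, fun s hs => ?_⟩
      have e : {θ : Fin G → ℝ | ∀ g, |θ g - τ g| ≤ ρ g / s} = Set.univ := by
        ext; simp
      rw [e, probReal_univ, numParams, pow_one]
      exact (div_le_one (by linarith)).2 hs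
    · have hne : (Finset.univ : Finset (Fin G)).Nonempty := ⟨g₀, Finset.mem_univ _⟩
      have hρ0 : 0 < Finset.univ.inf' hne ρ := (Finset.lt_inf'_iff _).2 fun g _ => hρ g
      obtain ⟨κ, hκ, H⟩ := le_betaMeasure_real_closedBall ha hb (hτ g₀) hρ0
      refine ⟨κ, hκ, fun s hs => ?_⟩
      have hs0 : 0 < s := by linarith
      have hmeas : MeasurableSet {θ : Fin G → ℝ | ∀ g, |θ g - τ g| ≤ ρ g / s} := by
        simp only [Set.ofPred_forall]
        exact MeasurableSet.iInter fun g => measurableSet_le (by fun_prop) (by fun_prop)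
      rw [law, numParams, pow_one, map_measureReal_apply (by fun_prop) hmeas]
      refine (H s hs).trans (measureReal_mono fun x hx g => ?_)
      rw [eq_of_mem_support_tied hp g g₀]
      refine (show |x - τ g₀| ≤ _ from hx).trans ?_
      gcongr
      exact Finset.inf'_le _ (Finset.mem_univ g)
  · refine ⟨1, one_pos, fun s hs => ?_⟩
    have hs0 : 0 < s := by linarith
    have h1 := eq_of_mem_support_const hp
    have hmem : (fun _ : Fin G => c) ∈ {θ : Fin G → ℝ | ∀ g, |θ g - τ g| ≤ ρ g / s} := by
      intro g
      rw [h1]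
      simpa using (div_pos (hρ g) hs0).le
    rw [law, numParams, pow_zero, div_one, measureReal_def, Measure.dirac_apply_of_mem hmem,
      ENNReal.toReal_one]

/-- Each free parameter yields one one-dimensional Gaussian integral. A tied prior counts one
parameter even without groups, and then no factor would provide the decay; hence `0 < G`. -/
theorem integral_prod_exp_neg_sq_le (hG : 0 < G) (p : NodePrior G) {τ : Fin G → ℝ}
    (hτ : ∀ g, τ g ∈ Set.Ioo (0 : ℝ) 1) {c : ℝ} (hc : 0 < c) (hp : τ ∈ p.law.support) :
    ∃ C > 0, ∀ s ≥ (1 : ℝ),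
      ∫ θ, ∏ g, Real.exp (-c * s ^ 2 * (θ g - τ g) ^ 2) ∂p.law ≤ C / s ^ p.numParams := by
  rcases p with ⟨a, b, ha, hb⟩ | ⟨a, b, ha, hb⟩ | ⟨c', hc'⟩
  · have := fun g => isProbabilityMeasureBeta (ha g) (hb g)
    choose C hC H using fun g => integral_exp_neg_sq_betaMeasure_le (ha g) (hb g) (hτ g) hc
    refine ⟨∏ g, C g, Finset.prod_pos fun g _ => hC g, fun s hs => ?_⟩
    rw [law, numParams,
      integral_fintype_prod_eq_prod (f := fun g x => Real.exp (-c * s ^ 2 * (x - τ g) ^ 2))]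
    calc _ ≤ ∏ g, C g / s := Finset.prod_le_prod
          (fun g _ => integral_nonneg fun x => (Real.exp_pos _).le) fun g _ => H g s hs
      _ = _ := by simp [Finset.prod_div_distrib]
  · have := isProbabilityMeasureBeta ha hb
    obtain ⟨C, hC, H⟩ := integral_exp_neg_sq_betaMeasure_le ha hb (hτ ⟨0, hG⟩) hc
    refine ⟨C, hC, fun s hs => ?_⟩
    have hs0 : 0 < s := by linarith
    have hle : ∀ x y : ℝ, Real.exp (-c * s ^ 2 * (x - y) ^ 2) ≤ 1 := fun x y => by
      rw [Real.exp_le_one_iff, neg_mul, neg_mul, neg_nonpos]; positivity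
    rw [law, numParams, pow_one, integral_map (by fun_prop)
      (Continuous.aestronglyMeasurable (by fun_prop))]
    refine le_trans (integral_mono_of_nonneg (ae_of_all _ fun x => ?_) ?_
      (ae_of_all _ fun x => ?_)) (H s hs)
    · exact Finset.prod_nonneg fun g _ => (Real.exp_pos _).le
    · refine Integrable.of_bound (Continuous.aestronglyMeasurable (by fun_prop)) 1
        (ae_of_all _ fun x => ?_)
      rw [Real.norm_of_nonneg (Real.exp_pos _).le]
      exact hle _ _
    · simp only
      -- Under the tied prior one group already gives the order `1 / s`; the other factors are
      -- bounded by one.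
      rw [← Finset.mul_prod_erase _ _ (Finset.mem_univ (⟨0, hG⟩ : Fin G))]
      exact mul_le_of_le_one_right (Real.exp_pos _).le
        (Finset.prod_le_one (fun _ _ => (Real.exp_pos _).le) fun _ _ => hle _ _)
  · refine ⟨1, one_pos, fun s hs => ?_⟩
    have h1 := eq_of_mem_support_const hp
    rw [law, integral_dirac, h1]
    simp [numParams]

/-- Some ball about `τ` is null for the prior, so almost surely some coordinate is at least `δ` away
and its factor alone is exponentially small. -/
theorem integral_prod_exp_neg_sq_le_of_notMem_support (p : NodePrior G) {τ : Fin G → ℝ}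
    {c : ℝ} (hc : 0 < c) (hp : τ ∉ p.law.support) (q : ℕ) :
    ∃ C > 0, ∀ s ≥ (1 : ℝ),
      ∫ θ, ∏ g, Real.exp (-c * s ^ 2 * (θ g - τ g) ^ 2) ∂p.law ≤ C / s ^ q := by
  obtain ⟨U, hU, hU0⟩ := Measure.notMem_support_iff_exists.1 hp
  obtain ⟨δ, hδ, hball⟩ := Metric.mem_nhds_iff.1 hU
  have hae : ∀ᵐ θ ∂p.law, δ ≤ dist θ τ := by
    have : ∀ᵐ θ ∂p.law, θ ∉ U := measure_eq_zero_iff_ae_notMem.1 hU0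
    filter_upwards [this] with θ hθ
    by_contra h
    exact hθ (hball (not_le.1 h))
  obtain ⟨C, hC, H⟩ := exp_neg_mul_sq_le (c := c * δ ^ 2) (by positivity) q
  refine ⟨C, hC, fun s hs => le_trans ?_ (H s hs)⟩
  calc _ ≤ ∫ θ, Real.exp (-(c * δ ^ 2 * s ^ 2)) ∂p.law := by
        refine integral_mono_of_nonneg (ae_of_all _ fun x => ?_) (integrable_const _) ?_
        · exact Finset.prod_nonneg fun g _ => (Real.exp_pos _).le
        · filter_upwards [hae] with θ hθ
          obtain ⟨g, hg⟩ : ∃ g, δ ≤ dist (θ g) (τ g) := by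
            by_contra! h
            exact absurd ((dist_pi_lt_iff hδ).2 h) (not_lt.2 hθ)
          rw [← Finset.mul_prod_erase _ _ (Finset.mem_univ g)]
          refine (mul_le_of_le_one_right (Real.exp_pos _).le
            (Finset.prod_le_one (fun _ _ => (Real.exp_pos _).le) fun g' _ => ?_)).trans ?_
          · rw [Real.exp_le_one_iff, neg_mul, neg_mul, neg_nonpos]; positivity
          · apply Real.exp_le_exp.2
            have : δ ^ 2 ≤ (θ g - τ g) ^ 2 := by
              rw [← sq_abs (θ g - τ g), ← Real.dist_eq]
              exact pow_le_pow_left₀ hδ.le hg 2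
            have : 0 ≤ c * s ^ 2 := by positivity
            nlinarith
    _ = _ := by simp

/-- The marginal likelihood ratio at one node, of the prior `p` against the true conditional
probabilities `τ`, after `k g` observations of group `g` in the left child and `r g` in the
right child. -/
def marginalRatio (p : NodePrior G) (τ : Fin G → ℝ) (k r : Fin G → ℕ) : ℝ :=
  ∫ θ, ∏ g, bernoulliRatio (τ g) (k g) (r g) (θ g) ∂p.law

theorem marginalRatio_nonneg (p : NodePrior G) {τ : Fin G → ℝ}
    (hτ : ∀ g, τ g ∈ Set.Ioo (0 : ℝ) 1) (k r : Fin G → ℕ) : 0 ≤ p.marginalRatio τ k r := by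
  refine integral_nonneg_of_ae ?_
  filter_upwards [p.ae_mem_Ioo] with θ hθ
  exact Finset.prod_nonneg fun g _ => (bernoulliRatio_pos (hτ g) (hθ g) _ _).le

theorem exists_marginalRatio_le_integral (p : NodePrior G) {τ : Fin G → ℝ}
    (hτ : ∀ g, τ g ∈ Set.Ioo (0 : ℝ) 1) {c : ℝ} (hc : 0 < c) (M : ℝ) :
    ∃ K > 0, ∀ s > 0, ∀ k r : Fin G → ℕ, (∀ g, TypicalCounts (τ g) c M s (k g) (r g)) →
      p.marginalRatio τ k r ≤
        K * ∫ θ, ∏ g, Real.exp (-(c / 8) * s ^ 2 * (θ g - τ g) ^ 2) ∂p.law := by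
  choose K hK H using fun g => bernoulliRatio_le (M := M) (hτ g) hc
  refine ⟨∏ g, K g, Finset.prod_pos fun g _ => hK g, fun s hs k r hkr => ?_⟩
  rw [← integral_const_mul]
  refine integral_mono_of_nonneg ?_ (Integrable.const_mul ?_ _) ?_
  · filter_upwards [p.ae_mem_Ioo] with θ hθ
    exact Finset.prod_nonneg fun g _ => (bernoulliRatio_pos (hτ g) (hθ g) _ _).le
  · refine Integrable.of_bound (Continuous.aestronglyMeasurable (by fun_prop)) 1
      (ae_of_all _ fun x => ?_)
    rw [Real.norm_of_nonneg (Finset.prod_nonneg fun g _ => (Real.exp_pos _).le)]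
    refine Finset.prod_le_one (fun _ _ => (Real.exp_pos _).le) fun g' _ => ?_
    rw [Real.exp_le_one_iff, neg_mul, neg_mul, neg_nonpos]; positivity
  · filter_upwards [p.ae_mem_Ioo] with θ hθ
    rw [← Finset.prod_mul_distrib]
    exact Finset.prod_le_prod (fun g _ => (bernoulliRatio_pos (hτ g) (hθ g) _ _).le)
      fun g _ => H g s hs _ _ (hkr g) _ (hθ g)

theorem marginalRatio_le (hG : 0 < G) (p : NodePrior G) {τ : Fin G → ℝ}
    (hτ : ∀ g, τ g ∈ Set.Ioo (0 : ℝ) 1) {c : ℝ} (hc : 0 < c) (M : ℝ) (hp : τ ∈ p.law.support) :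
    ∃ C > 0, ∀ s ≥ (1 : ℝ), ∀ k r : Fin G → ℕ, (∀ g, TypicalCounts (τ g) c M s (k g) (r g)) →
      p.marginalRatio τ k r ≤ C / s ^ p.numParams := by
  obtain ⟨K, hK, H⟩ := p.exists_marginalRatio_le_integral hτ hc M
  obtain ⟨C, hC, H'⟩ := p.integral_prod_exp_neg_sq_le hG hτ (c := c / 8) (by positivity) hp
  refine ⟨K * C, by positivity, fun s hs k r hkr => (H s (by linarith) k r hkr).trans ?_⟩
  rw [mul_div_assoc]
  exact mul_le_mul_of_nonneg_left (H' s hs) hK.le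

theorem marginalRatio_le_of_notMem_support (p : NodePrior G) {τ : Fin G → ℝ}
    (hτ : ∀ g, τ g ∈ Set.Ioo (0 : ℝ) 1) {c : ℝ} (hc : 0 < c) (M : ℝ)
    (hp : τ ∉ p.law.support) (q : ℕ) :
    ∃ C > 0, ∀ s ≥ (1 : ℝ), ∀ k r : Fin G → ℕ, (∀ g, TypicalCounts (τ g) c M s (k g) (r g)) →
      p.marginalRatio τ k r ≤ C / s ^ q := by
  obtain ⟨K, hK, H⟩ := p.exists_marginalRatio_le_integral hτ hc M
  obtain ⟨C, hC, H'⟩ :=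
    p.integral_prod_exp_neg_sq_le_of_notMem_support (c := c / 8) (by positivity) hp q
  refine ⟨K * C, by positivity, fun s hs k r hkr => (H s (by linarith) k r hkr).trans ?_⟩
  rw [mul_div_assoc]
  exact mul_le_mul_of_nonneg_left (H' s hs) hK.le

/-- Restricting the integral to the ball of radius of order `1 / s`, where the ratio is bounded
below, leaves a constant times the prior mass of that ball. -/
theorem le_marginalRatio (p : NodePrior G) {τ : Fin G → ℝ}
    (hτ : ∀ g, τ g ∈ Set.Ioo (0 : ℝ) 1) {c : ℝ} (hc : 0 < c) (M : ℝ) (hp : τ ∈ p.law.support) :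
    ∃ κ > 0, ∀ s ≥ (1 : ℝ), ∀ k r : Fin G → ℕ, (∀ g, TypicalCounts (τ g) c M s (k g) (r g)) →
      κ / s ^ p.numParams ≤ p.marginalRatio τ k r := by
  choose K hK HK using fun g => bernoulliRatio_le (M := M) (hτ g) hc
  choose κ hκ ρ hρ H using fun g => le_bernoulliRatio (c := c) (M := M) (hτ g)
  obtain ⟨κ', hκ', H'⟩ := p.le_law_real_pi_closedBall hτ hρ hp
  refine ⟨(∏ g, κ g) * κ', mul_pos (Finset.prod_pos fun g _ => hκ g) hκ', fun s hs k r hkr => ?_⟩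
  have hs0 : 0 < s := by linarith
  have hmeas : MeasurableSet {θ : Fin G → ℝ | ∀ g, |θ g - τ g| ≤ ρ g / s} := by
    simp only [Set.ofPred_forall]
    exact MeasurableSet.iInter fun g => measurableSet_le (by fun_prop) (by fun_prop)
  -- The upper bound on the ratio serves only for integrability.
  have hint : Integrable (fun θ => ∏ g, bernoulliRatio (τ g) (k g) (r g) (θ g)) p.law := by
    refine Integrable.of_bound (Continuous.aestronglyMeasurable (by fun_prop)) (∏ g, K g) ?_
    filter_upwards [p.ae_mem_Ioo] with θ hθ
    rw [Real.norm_of_nonneg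
      (Finset.prod_nonneg fun g _ => (bernoulliRatio_pos (hτ g) (hθ g) _ _).le)]
    refine Finset.prod_le_prod (fun g _ => (bernoulliRatio_pos (hτ g) (hθ g) _ _).le)
      fun g _ => (HK g s hs0 _ _ (hkr g) _ (hθ g)).trans ?_
    refine mul_le_of_le_one_right (hK g).le ?_
    rw [Real.exp_le_one_iff, neg_mul, neg_mul, neg_nonpos]; positivity
  calc (∏ g, κ g) * κ' / s ^ p.numParams
      ≤ (∏ g, κ g) * p.law.real {θ | ∀ g, |θ g - τ g| ≤ ρ g / s} := by
        rw [mul_div_assoc]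
        exact mul_le_mul_of_nonneg_left (H' s hs) (Finset.prod_pos fun g _ => hκ g).le
    _ = ∫ θ in {θ | ∀ g, |θ g - τ g| ≤ ρ g / s}, ∏ g, κ g ∂p.law := by
        rw [setIntegral_const, smul_eq_mul, mul_comm]
    _ ≤ ∫ θ in {θ | ∀ g, |θ g - τ g| ≤ ρ g / s},
          ∏ g, bernoulliRatio (τ g) (k g) (r g) (θ g) ∂p.law := by
        refine setIntegral_mono_on (integrable_const _).integrableOn hint.integrableOn hmeas
          fun θ hθ => ?_
        exact Finset.prod_le_prod (fun g _ => (hκ g).le)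
          fun g _ => (H g s hs _ _ (hkr g) _ (hθ g)).2
    _ ≤ _ := by
        refine setIntegral_le_integral hint ?_
        filter_upwards [p.ae_mem_Ioo] with θ hθ
        exact Finset.prod_nonneg fun g _ => (bernoulliRatio_pos (hτ g) (hθ g) _ _).le

end NodePrior

/-! ### Geometry of the cuts. -/

section Boxes

variable {d : ℕ}

theorem mem_cutLeft {B : BoxIntegral.Box (Fin d)} {j : Fin d} {s : Set.Ioo (0 : ℝ) 1}
    {x : Fin d → ℝ} : x ∈ cutLeft B j s ↔ x ∈ B ∧ x j ≤ cutPoint B j s := by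
  simp only [BoxIntegral.Box.mem_def, cutLeft, Set.mem_Ioc]
  refine ⟨fun h => ⟨fun i => ⟨(h i).1, ?_⟩, by simpa using (h j).2⟩, fun h i => ⟨(h.1 i).1, ?_⟩⟩
  · by_cases hi : i = j
    · subst hi
      have := (h i).2
      rw [Function.update_self] at this
      exact this.trans (cutPoint_lt_upper B i s).le
    · simpa [hi] using (h i).2
  · by_cases hi : i = j
    · subst hi; simpa using h.2
    · simpa [hi] using (h.1 i).2

theorem mem_cutRight {B : BoxIntegral.Box (Fin d)} {j : Fin d} {s : Set.Ioo (0 : ℝ) 1}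
    {x : Fin d → ℝ} : x ∈ cutRight B j s ↔ x ∈ B ∧ cutPoint B j s < x j := by
  simp only [BoxIntegral.Box.mem_def, cutRight, Set.mem_Ioc]
  refine ⟨fun h => ⟨fun i => ⟨?_, (h i).2⟩, by simpa using (h j).1⟩, fun h i => ⟨?_, (h.1 i).2⟩⟩
  · by_cases hi : i = j
    · subst hi
      have := (h i).1
      rw [Function.update_self] at this
      exact (lower_lt_cutPoint B i s).trans this
    · simpa [hi] using (h i).1
  · by_cases hi : i = j
    · subst hi; simpa using h.2
    · simpa [hi] using (h.1 i).1

theorem cutLeft_subset (B : BoxIntegral.Box (Fin d)) (j : Fin d) (s : Set.Ioo (0 : ℝ) 1) :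
    (cutLeft B j s : Set (Fin d → ℝ)) ⊆ B := fun _ hx => (mem_cutLeft.1 hx).1

theorem cutRight_subset (B : BoxIntegral.Box (Fin d)) (j : Fin d) (s : Set.Ioo (0 : ℝ) 1) :
    (cutRight B j s : Set (Fin d → ℝ)) ⊆ B := fun _ hx => (mem_cutRight.1 hx).1

theorem Node.boxIn_subset : {T : PTree d} → (A : Node T) → (B : BoxIntegral.Box (Fin d)) →
    (A.boxIn B : Set (Fin d → ℝ)) ⊆ B
  | _, .root, _ => subset_rfl
  | .split _ _ _ _, .left A, _ => (A.boxIn_subset _).trans (cutLeft_subset _ _ _)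
  | .split _ _ _ _, .right A, _ => (A.boxIn_subset _).trans (cutRight_subset _ _ _)

theorem Node.leftBoxIn_subset : {T : PTree d} → (A : Node T) → (B : BoxIntegral.Box (Fin d)) →
    (A.leftBoxIn B : Set (Fin d → ℝ)) ⊆ A.boxIn B
  | .split _ _ _ _, .root, _ => cutLeft_subset _ _ _
  | .split _ _ _ _, .left A, _ => A.leftBoxIn_subset _
  | .split _ _ _ _, .right A, _ => A.leftBoxIn_subset _

/-- The part of a node outside its left child contains the right child, a box. -/
theorem Node.exists_box_subset_diff : {T : PTree d} → (A : Node T) →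
    (B : BoxIntegral.Box (Fin d)) →
    ∃ R : BoxIntegral.Box (Fin d), (R : Set (Fin d → ℝ)) ⊆ A.boxIn B \ A.leftBoxIn B
  | .split j s _ _, .root, B => ⟨cutRight B j s, fun _ hx =>
      ⟨cutRight_subset _ _ _ hx, fun hl => (mem_cutLeft.1 hl).2.not_gt (mem_cutRight.1 hx).2⟩⟩
  | .split _ _ _ _, .left A, _ => A.exists_box_subset_diff _
  | .split _ _ _ _, .right A, _ => A.exists_box_subset_diff _

theorem volume_box_pos (B : BoxIntegral.Box (Fin d)) : 0 < volume (B : Set (Fin d → ℝ)) := by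
  have h := B.volume_apply'
  have hpos : 0 < ∏ i, (B.upper i - B.lower i) :=
    Finset.prod_pos fun i _ => sub_pos.2 (B.lower_lt_upper i)
  exact (ENNReal.toReal_pos_iff.1 (h ▸ hpos)).1

end Boxes

/-! ### Factorization of the likelihood over the nodes. -/

section Density

variable {d : ℕ}

open Classical in
/-- The contribution of a node of conditional probability `θ` to the density at the points which
lie in the left part `L`, respectively elsewhere in the node `A`. -/
def splitFactor (L A : Set (Fin d → ℝ)) (θ : ℝ) (x : Fin d → ℝ) : ℝ :=
  if x ∈ L then θ else if x ∈ A then 1 - θ else 1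

theorem prod_node_split {j : Fin d} {s : Set.Ioo (0 : ℝ) 1} {l r : PTree d}
    (f : Node (.split j s l r) → ℝ) :
    ∏ A, f A = f .root * ((∏ A : Node l, f (.left A)) * ∏ A : Node r, f (.right A)) := by
  rw [← Fintype.prod_equiv (nodeSplitEquiv j s l r) (fun o => f (nodeSplitEquiv j s l r o)) f
    fun _ => rfl, Fintype.prod_option, Fintype.prod_sum_type]
  rfl

theorem densityIn_of_notMem : (T : PTree d) → (B : BoxIntegral.Box (Fin d)) → (θ : Node T → ℝ) →
    {x : Fin d → ℝ} → x ∉ B → densityIn T B θ x = 0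
  | .leaf, B, _, _, hx => Set.indicator_of_notMem (s := (B : Set (Fin d → ℝ))) hx _
  | .split j s l r, B, θ, x, hx => by
    have h1 : x ∉ cutLeft B j s := fun h => hx (mem_cutLeft.1 h).1
    have h2 : x ∉ cutRight B j s := fun h => hx (mem_cutRight.1 h).1
    rw [densityIn, densityIn_of_notMem l _ _ h1, densityIn_of_notMem r _ _ h2]
    ring

theorem prod_splitFactor_of_notMem {T : PTree d} {B : BoxIntegral.Box (Fin d)} (θ : Node T → ℝ)
    {x : Fin d → ℝ} (hx : x ∉ B) :
    ∏ A : Node T, splitFactor (A.leftBoxIn B) (A.boxIn B) (θ A) x = 1 := by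
  refine Finset.prod_eq_one fun A _ => ?_
  have h1 : x ∉ (A.boxIn B : Set (Fin d → ℝ)) := fun h => hx (A.boxIn_subset B h)
  have h2 : x ∉ (A.leftBoxIn B : Set (Fin d → ℝ)) := fun h => h1 (A.leftBoxIn_subset B h)
  rw [splitFactor, if_neg h2, if_neg h1]

/-- The point lies in exactly one child of each node on its branch, and nodes off the branch
contribute the factor one. `D` is the inverse volume of the terminal box reached, hence free of `θ`.
-/
theorem exists_densityIn_eq_mul_prod : (T : PTree d) → (B : BoxIntegral.Box (Fin d)) →
    {x : Fin d → ℝ} → x ∈ B → ∃ D > 0, ∀ θ : Node T → ℝ,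
      densityIn T B θ x = D * ∏ A : Node T, splitFactor (A.leftBoxIn B) (A.boxIn B) (θ A) x
  | .leaf, B, x, hx => by
    refine ⟨1 / volume.real (B : Set (Fin d → ℝ)), ?_, fun θ => ?_⟩
    · have : 0 < volume.real (B : Set (Fin d → ℝ)) := by
        rw [measureReal_def, B.volume_apply']
        exact Finset.prod_pos fun i _ => sub_pos.2 (B.lower_lt_upper i)
      positivity
    · rw [Finset.univ_eq_empty, Finset.prod_empty, mul_one, densityIn]
      exact Set.indicator_of_mem (s := (B : Set (Fin d → ℝ))) hx _
  | .split j s l r, B, x, hx => by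
    by_cases hj : x j ≤ cutPoint B j s
    · have h1 : x ∈ cutLeft B j s := mem_cutLeft.2 ⟨hx, hj⟩
      have h2 : x ∉ cutRight B j s := fun h => hj.not_gt (mem_cutRight.1 h).2
      obtain ⟨D, hD, H⟩ := exists_densityIn_eq_mul_prod l _ h1
      refine ⟨D, hD, fun θ => ?_⟩
      rw [densityIn, H, densityIn_of_notMem r _ _ h2, prod_node_split]
      have e := prod_splitFactor_of_notMem (T := r) (fun A => θ (.right A)) h2
      have e0 : splitFactor ((Node.root : Node (.split j s l r)).leftBoxIn B)
          ((Node.root : Node (.split j s l r)).boxIn B) (θ .root) x = θ .root := if_pos h1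
      simp only [Node.leftBoxIn, Node.boxIn] at e0 ⊢
      rw [e, e0]
      ring
    · have h1 : x ∉ cutLeft B j s := fun h => hj (mem_cutLeft.1 h).2
      have h2 : x ∈ cutRight B j s := mem_cutRight.2 ⟨hx, not_le.1 hj⟩
      obtain ⟨D, hD, H⟩ := exists_densityIn_eq_mul_prod r _ h2
      refine ⟨D, hD, fun θ => ?_⟩
      rw [densityIn, H, densityIn_of_notMem l _ _ h1, prod_node_split]
      have e := prod_splitFactor_of_notMem (T := l) (fun A => θ (.left A)) h1
      have e0 : splitFactor ((Node.root : Node (.split j s l r)).leftBoxIn B)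
          ((Node.root : Node (.split j s l r)).boxIn B) (θ .root) x = 1 - θ .root :=
        (if_neg h1).trans (if_pos hx)
      simp only [Node.leftBoxIn, Node.boxIn] at e0 ⊢
      rw [e, e0]
      ring

open Classical in
/-- The number of the first `m` points of a sequence that lie in a set. -/
def hitCount (x : ℕ → Fin d → ℝ) (s : Set (Fin d → ℝ)) (m : ℕ) : ℕ :=
  ((Finset.range m).filter fun i => x i ∈ s).card

theorem hitCount_le (x : ℕ → Fin d → ℝ) (s : Set (Fin d → ℝ)) (m : ℕ) : hitCount x s m ≤ m := by
  classical
  exact (Finset.card_filter_le _ _).trans (Finset.card_range m).le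

theorem hitCount_eq_sum (x : ℕ → Fin d → ℝ) (s : Set (Fin d → ℝ)) (m : ℕ) :
    (hitCount x s m : ℝ) = ∑ i ∈ Finset.range m, s.indicator (fun _ => (1 : ℝ)) (x i) := by
  classical
  simp [hitCount, Set.indicator_apply]

theorem hitCount_add_hitCount_diff (x : ℕ → Fin d → ℝ) {s t : Set (Fin d → ℝ)} (h : s ⊆ t)
    (m : ℕ) : hitCount x s m + hitCount x (t \ s) m = hitCount x t m := by
  have : ((hitCount x s m + hitCount x (t \ s) m : ℕ) : ℝ) = hitCount x t m := by
    push_cast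
    simp only [hitCount_eq_sum, ← Finset.sum_add_distrib]
    refine Finset.sum_congr rfl fun i _ => ?_
    have := congr_fun (Set.indicator_self_add_compl s (t.indicator fun _ => (1 : ℝ))) (x i)
    rw [Pi.add_apply, Set.indicator_indicator, Set.indicator_indicator,
      Set.inter_eq_left.2 h, Set.inter_comm, ← Set.sdiff_eq] at this
    exact this
  exact_mod_cast this

theorem prod_splitFactor (x : ℕ → Fin d → ℝ) (L A : Set (Fin d → ℝ)) (θ : ℝ) (m : ℕ) :
    ∏ i ∈ Finset.range m, splitFactor L A θ (x i)
      = θ ^ hitCount x L m * (1 - θ) ^ hitCount x (A \ L) m := by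
  classical
  have e : ∀ y, splitFactor L A θ y
      = (if y ∈ L then θ else 1) * (if y ∈ A \ L then 1 - θ else 1) := fun y => by
    unfold splitFactor
    by_cases h1 : y ∈ L
    · simp [h1]
    · by_cases h2 : y ∈ A <;> simp [h1, h2]
  simp only [e, Finset.prod_mul_distrib, Finset.prod_ite, Finset.prod_const_one, mul_one,
    Finset.prod_const, hitCount]
  congr!

theorem pow_mul_pow_eq_mul_bernoulliRatio {t : ℝ} (ht : t ∈ Set.Ioo (0 : ℝ) 1) (k r : ℕ) (θ : ℝ) :
    θ ^ k * (1 - θ) ^ r = t ^ k * (1 - t) ^ r * bernoulliRatio t k r θ := by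
  have h1 := ht.1.ne'
  have h2 := (sub_pos.2 ht.2).ne'
  unfold bernoulliRatio
  rw [div_pow, div_pow]
  field_simp

variable {G I : ℕ} {T : PTree d} (M : Model T G I)

/-- The likelihood of the states factorizes over the nodes, up to a constant that does not depend
on the states. -/
theorem Model.exists_likelihood_eq_mul_prod {τ : Node T → Fin G → ℝ}
    (hτ : ∀ A g, τ A g ∈ Set.Ioo (0 : ℝ) 1) (m : Fin G → ℕ) {x : Fin G → ℕ → Fin d → ℝ}
    (hx : ∀ g i, x g i ∈ unitBox d) :
    ∃ D > 0, ∀ v, M.likelihood m x v = D * ∏ A, (M.prior A (v A)).marginalRatio (τ A)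
      (fun g => hitCount (x g) A.leftRegion (m g))
      (fun g => hitCount (x g) (A.region \ A.leftRegion) (m g)) := by
  choose D hD H using fun g i => exists_densityIn_eq_mul_prod T (unitBox d) (hx g i)
  set k : Node T → Fin G → ℕ := fun A g => hitCount (x g) A.leftRegion (m g) with hk
  set r : Node T → Fin G → ℕ := fun A g => hitCount (x g) (A.region \ A.leftRegion) (m g) with hr
  -- `D₀` collects the inverse volumes of the terminal nodes and `E` is the likelihood factor at
  -- `τ`; neither depends on the states.
  set D₀ := ∏ g, ∏ i ∈ Finset.range (m g), D g i with hD₀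
  set E := ∏ A, ∏ g, τ A g ^ k A g * (1 - τ A g) ^ r A g with hE
  have hE0 : 0 < E := Finset.prod_pos fun A _ => Finset.prod_pos fun g _ =>
    mul_pos (pow_pos (hτ A g).1 _) (pow_pos (sub_pos.2 (hτ A g).2) _)
  have hD0 : 0 < D₀ := Finset.prod_pos fun g _ => Finset.prod_pos fun i _ => hD g i
  refine ⟨D₀ * E, mul_pos hD0 hE0, fun v => ?_⟩
  have key : ∀ θ : Node T → Fin G → ℝ,
      ∏ g : Fin G, ∏ i ∈ Finset.range (m g), density T (fun A => θ A g) (x g i)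
        = D₀ * E * ∏ A, ∏ g, bernoulliRatio (τ A g) (k A g) (r A g) (θ A g) := fun θ => by
    have e1 : ∀ g, ∏ i ∈ Finset.range (m g), density T (fun A => θ A g) (x g i)
        = (∏ i ∈ Finset.range (m g), D g i) * ∏ A, τ A g ^ k A g * (1 - τ A g) ^ r A g *
          bernoulliRatio (τ A g) (k A g) (r A g) (θ A g) := fun g => by
      simp only [density, H, Finset.prod_mul_distrib]
      congr 1
      rw [Finset.prod_comm, ← Finset.prod_mul_distrib, ← Finset.prod_mul_distrib]
      refine Finset.prod_congr rfl fun A _ => ?_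
      rw [prod_splitFactor, ← pow_mul_pow_eq_mul_bernoulliRatio (hτ A g)]
      rfl
    simp only [e1]
    rw [mul_assoc, hE, ← Finset.prod_mul_distrib]
    simp only [← Finset.prod_mul_distrib (s := (Finset.univ : Finset (Fin G)))]
    rw [Finset.prod_mul_distrib, Finset.prod_comm (s := (Finset.univ : Finset (Fin G)))]
  unfold Model.likelihood Model.thetaLaw
  simp only [key]
  -- Independence of the node priors given the states splits the integral of the product.
  rw [integral_const_mul, integral_fintype_prod_eq_prod
    (f := fun A (θ : Fin G → ℝ) => ∏ g, bernoulliRatio (τ A g) (k A g) (r A g) (θ g))]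
  rfl

end Density

/-! ### Concentration of the counts and positivity of the cells. -/

section Probability

variable {d : ℕ}

/-- Chebyshev's inequality for the number of observations in a set. -/
theorem measureReal_lt_abs_hitCount_sub_le {S : Type*} [MeasurableSpace S] {ν : Measure S}
    [IsProbabilityMeasure ν] {P : Measure (Fin d → ℝ)} {X : ℕ → S → Fin d → ℝ}
    (hind : Pairwise fun i j => X i ⟂ᵢ[ν] X j) (hlaw : ∀ i, HasLaw (X i) P ν)
    {B : Set (Fin d → ℝ)} (hB : MeasurableSet B) {m n : ℕ} (hmn : m ≤ n) (hn : 0 < n)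
    {M : ℝ} (hM : 0 < M) :
    ν.real {ω | M * √n < |(hitCount (fun i => X i ω) B m : ℝ) - m * P.real B|} ≤ 1 / M ^ 2 := by
  set f : (Fin d → ℝ) → ℝ := B.indicator fun _ => 1 with hf
  have hfm : Measurable f := measurable_const.indicator hB
  have hf01 : ∀ y, f y ∈ Set.Icc (0 : ℝ) 1 := fun y => by
    by_cases h : y ∈ B <;> simp [hf, h]
  have haem : ∀ i, AEMeasurable (fun ω => f (X i ω)) ν := fun i =>
    hfm.comp_aemeasurable (hlaw i).aemeasurable
  have hmem : ∀ i, MemLp (fun ω => f (X i ω)) 2 ν := fun i =>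
    MemLp.of_bound (haem i).aestronglyMeasurable 1 (ae_of_all _ fun ω => by
      rw [Real.norm_of_nonneg (hf01 _).1]; exact (hf01 _).2)
  have hvar : ∀ i, variance (fun ω => f (X i ω)) ν ≤ 1 := fun i => by
    have := variance_le_sq_of_bounded (μ := ν) (ae_of_all _ fun ω => hf01 (X i ω)) (haem i)
    refine this.trans (by norm_num)
  have hmean : ∀ i, ∫ ω, f (X i ω) ∂ν = P.real B := fun i => by
    rw [← integral_indicator_one hB, ← (hlaw i).map_eq,
      integral_map (hlaw i).aemeasurable (measurable_one.indicator hB).aestronglyMeasurable]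
    rfl
  set Y : S → ℝ := ∑ i ∈ Finset.range m, fun ω => f (X i ω) with hY
  have hYω : ∀ ω, (hitCount (fun i => X i ω) B m : ℝ) = Y ω := fun ω => by
    rw [hitCount_eq_sum, hY, Finset.sum_apply]
  have hYmean : ∫ ω, Y ω ∂ν = m * P.real B := by
    simp only [hY, Finset.sum_apply]
    rw [integral_finsetSum _ fun i _ => (hmem i).integrable (by norm_num)]
    simp [hmean]
  have hYvar : variance Y ν ≤ n := by
    rw [hY, IndepFun.variance_sum (fun i _ => hmem i)
      fun i _ j _ hij => (hind hij).comp hfm hfm]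
    calc _ ≤ ∑ i ∈ Finset.range m, (1 : ℝ) := Finset.sum_le_sum fun i _ => hvar i
      _ = m := by simp
      _ ≤ n := by exact_mod_cast hmn
  have hn0 : (0 : ℝ) < n := by exact_mod_cast hn
  have hMn : 0 < M * √n := mul_pos hM (Real.sqrt_pos.2 hn0)
  have hch := meas_ge_le_variance_div_sq (μ := ν) (X := Y)
    (memLp_finsetSum' _ fun i _ => hmem i) hMn
  rw [hYmean] at hch
  have h1 : ν {ω | M * √n < |(hitCount (fun i => X i ω) B m : ℝ) - m * P.real B|}
      ≤ ENNReal.ofReal (1 / M ^ 2) := by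
    refine (measure_mono fun ω hω => ?_).trans (hch.trans (ENNReal.ofReal_le_ofReal ?_))
    · have : M * √n < |(hitCount (fun i => X i ω) B m : ℝ) - m * P.real B| := hω
      rw [hYω] at this
      exact this.le
    · rw [mul_pow, Real.sq_sqrt hn0.le, div_le_div_iff₀ (by positivity) (by positivity)]
      nlinarith [sq_nonneg M]
  exact ENNReal.toReal_le_of_le_ofReal (by positivity) h1

/-- An almost everywhere positive density makes Lebesgue measure on the unit box absolutely
continuous with respect to `P`, and boxes have positive volume. -/
theorem measureReal_box_pos {P : Measure (Fin d → ℝ)} [IsProbabilityMeasure P]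
    (hP : P ≪ volume.restrict (unitBox d : Set (Fin d → ℝ)))
    (hp : ∀ᵐ x ∂(volume.restrict (unitBox d : Set (Fin d → ℝ))),
      0 < P.rnDeriv (volume.restrict (unitBox d : Set (Fin d → ℝ))) x)
    {B : BoxIntegral.Box (Fin d)} (hB : (B : Set (Fin d → ℝ)) ⊆ unitBox d)
    {s : Set (Fin d → ℝ)} (hs : (B : Set (Fin d → ℝ)) ⊆ s) : 0 < P.real s := by
  have hac : volume.restrict (unitBox d : Set (Fin d → ℝ)) ≪ P := by
    conv_rhs => rw [← Measure.withDensity_rnDeriv_eq _ _ hP]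
    exact withDensity_absolutelyContinuous' (Measure.measurable_rnDeriv _ _).aemeasurable
      (hp.mono fun _ h => h.ne')
  have h1 : P s ≠ 0 := fun h0 => by
    have := hac (measure_mono_null hs h0)
    rw [Measure.restrict_apply B.measurableSet_coe, Set.inter_eq_left.2 hB] at this
    exact (volume_box_pos B).ne' this
  exact ENNReal.toReal_pos h1 (measure_ne_top _ _)

theorem exists_pos_forall_le {ι : Type*} [Finite ι] {f : ι → ℝ} (hf : ∀ i, 0 < f i) :
    ∃ c > 0, ∀ i, c ≤ f i := by
  have h : ∀ᶠ c in nhdsWithin (0 : ℝ) (Set.Ioi 0), ∀ i, c ≤ f i :=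
    eventually_all.2 fun i => nhdsWithin_le_nhds (eventually_le_nhds (hf i))
  obtain ⟨c, h1, h2⟩ := (h.and self_mem_nhdsWithin).exists
  exact ⟨c, h2, h1⟩

/-- The probability of the left child of a node given the node. -/
def splitProb {T : PTree d} (P : Measure (Fin d → ℝ)) (A : Node T) : ℝ :=
  (ProbabilityTheory.cond P A.region).real A.leftRegion

variable {T : PTree d}

theorem leftRegion_subset (A : Node T) : A.leftRegion ⊆ A.region := A.leftBoxIn_subset _

theorem measurableSet_region (A : Node T) : MeasurableSet A.region :=
  BoxIntegral.Box.measurableSet_coe _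

theorem measurableSet_leftRegion (A : Node T) : MeasurableSet A.leftRegion :=
  BoxIntegral.Box.measurableSet_coe _

theorem measureReal_leftRegion {P : Measure (Fin d → ℝ)} [IsProbabilityMeasure P] (A : Node T)
    (h : 0 < P.real A.region) : P.real A.leftRegion = splitProb P A * P.real A.region := by
  rw [splitProb, measureReal_def (P[|A.region]), cond_apply (measurableSet_region A),
    Set.inter_eq_right.2 (leftRegion_subset A), ENNReal.toReal_mul, ENNReal.toReal_inv,
    ← measureReal_def, ← measureReal_def]
  field_simp

/-- Both children contain a box and so have positive mass. Interior values of `τ` are what the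
divisions in `bernoulliRatio` and the local beta bounds require. -/
theorem splitProb_mem_Ioo {P : Measure (Fin d → ℝ)} [IsProbabilityMeasure P]
    (hP : P ≪ volume.restrict (unitBox d : Set (Fin d → ℝ)))
    (hp : ∀ᵐ x ∂(volume.restrict (unitBox d : Set (Fin d → ℝ))),
      0 < P.rnDeriv (volume.restrict (unitBox d : Set (Fin d → ℝ))) x) (A : Node T) :
    0 < P.real A.region ∧ splitProb P A ∈ Set.Ioo (0 : ℝ) 1 := by
  have hsub : A.region ⊆ unitBox d := A.boxIn_subset _
  have hA : 0 < P.real A.region := measureReal_box_pos hP hp hsub subset_rfl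
  have hl : 0 < P.real A.leftRegion :=
    measureReal_box_pos hP hp ((leftRegion_subset A).trans hsub) subset_rfl
  obtain ⟨R, hR⟩ := A.exists_box_subset_diff (unitBox d)
  have hr : 0 < P.real (A.region \ A.leftRegion) :=
    measureReal_box_pos hP hp ((hR.trans Set.sdiff_subset).trans hsub) hR
  rw [measureReal_sdiff (leftRegion_subset A) (measurableSet_leftRegion A)] at hr
  have e := measureReal_leftRegion A hA
  refine ⟨hA, ?_, ?_⟩
  · exact pos_of_mul_pos_left (e ▸ hl) hA.le
  · by_contra h
    nlinarith [not_lt.1 h]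

theorem typicalCounts_of_abs_sub_le {P : Measure (Fin d → ℝ)} [IsProbabilityMeasure P]
    {A : Node T} (hA : 0 < P.real A.region) (hτ : splitProb P A ∈ Set.Ioo (0 : ℝ) 1)
    {x : ℕ → Fin d → ℝ} {m n : ℕ} (hmn : m ≤ n) {M c : ℝ}
    (hm : c * n + M * √n ≤ m * P.real A.region)
    (h1 : |(hitCount x A.region m : ℝ) - m * P.real A.region| ≤ M * √n)
    (h2 : |(hitCount x A.leftRegion m : ℝ) - m * P.real A.leftRegion| ≤ M * √n) :
    TypicalCounts (splitProb P A) c (2 * M) √n (hitCount x A.leftRegion m)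
      (hitCount x (A.region \ A.leftRegion) m) := by
  have e : (hitCount x A.leftRegion m + hitCount x (A.region \ A.leftRegion) m : ℝ)
      = hitCount x A.region m := by
    exact_mod_cast hitCount_add_hitCount_diff x (leftRegion_subset A) m
  have hsq : √(n : ℝ) ^ 2 = n := Real.sq_sqrt n.cast_nonneg
  refine ⟨?_, ?_, ?_⟩
  · rw [e]
    rw [measureReal_leftRegion A hA] at h2
    -- The deviation is that of the left child minus `splitProb P A` times that of the node, whence
    -- the constant `2 * M`.
    have h3 : (hitCount x A.leftRegion m : ℝ) - hitCount x A.region m * splitProb P A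
        = (hitCount x A.leftRegion m - m * (splitProb P A * P.real A.region))
          - splitProb P A * (hitCount x A.region m - m * P.real A.region) := by ring
    rw [h3]
    refine (abs_sub _ _).trans ?_
    rw [abs_mul, abs_of_pos hτ.1]
    have := mul_le_of_le_one_left (abs_nonneg ((hitCount x A.region m : ℝ) - m * P.real A.region))
      hτ.2.le
    linarith
  · rw [e, hsq]
    have := (abs_le.1 h1).1
    linarith
  · rw [e, hsq]
    exact_mod_cast (hitCount_le _ _ _).trans hmn

end Probability

/-! ### Deterministic posterior bound for typical data. -/

namespace Model

variable {d G I : ℕ} {T : PTree d} (M : Model T G I)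

theorem stateProb_nonneg (v : Node T → Fin I) : 0 ≤ M.stateProb v := by
  refine Finset.prod_nonneg fun A _ => ?_
  split
  · exact M.init.2.1 _
  · exact (M.trans A _).2.1 _

/-- The set of feasible configurations of least complexity among the possible ones. -/
def feasibleOfLeastComplexity (P : Fin G → Measure (Fin d → ℝ)) : Set (Node T → Fin I) :=
  M.feasible P ∩ {v | IsLeast (M.complexity '' (M.feasible P ∩ M.possible)) (M.complexity v)}

theorem exists_isLeast_complexity {P : Fin G → Measure (Fin d → ℝ)}
    (hfeas : 0 < M.statePriorProb (M.feasible P)) :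
    ∃ v ∈ M.feasible P, 0 < M.stateProb v ∧
      IsLeast (M.complexity '' (M.feasible P ∩ M.possible)) (M.complexity v) := by
  have hne : (M.complexity '' (M.feasible P ∩ M.possible)).Nonempty := by
    obtain ⟨v, -, hv⟩ := Finset.exists_ne_zero_of_sum_ne_zero hfeas.ne'
    have hvF : v ∈ M.feasible P := Set.mem_of_indicator_ne_zero hv
    rw [Set.indicator_of_mem hvF] at hv
    exact ⟨_, v, ⟨hvF, (M.stateProb_nonneg v).lt_of_ne' hv⟩, rfl⟩
  obtain ⟨v, hv, e⟩ := Nat.sInf_mem hne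
  exact ⟨v, hv.1, hv.2, e ▸ Nat.sInf_mem hne, fun b hb => e ▸ Nat.sInf_le hb⟩

/-- The deficit is the weight of the complement over the total weight, and the total is at least the
weight of any single configuration. -/
theorem dist_statePosterior_one_le (m : Fin G → ℕ) (x : Fin G → ℕ → Fin d → ℝ)
    (S : Set (Node T → Fin I)) (hL : ∀ v, 0 ≤ M.likelihood m x v) {v₀ : Node T → Fin I}
    (hv₀ : 0 < M.stateProb v₀ * M.likelihood m x v₀) :
    dist (M.statePosterior m x S) 1 ≤
      (∑ v, Sᶜ.indicator (fun w => M.stateProb w * M.likelihood m x w) v) /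
        (M.stateProb v₀ * M.likelihood m x v₀) := by
  set w : (Node T → Fin I) → ℝ := fun v => M.stateProb v * M.likelihood m x v with hw
  have hw0 : ∀ v, 0 ≤ w v := fun v => mul_nonneg (M.stateProb_nonneg v) (hL v)
  have hW : w v₀ ≤ ∑ v, w v := Finset.single_le_sum (fun v _ => hw0 v) (Finset.mem_univ v₀)
  have hW0 : 0 < ∑ v, w v := lt_of_lt_of_le hv₀ hW
  have hsum : (∑ v, S.indicator w v) + ∑ v, Sᶜ.indicator w v = ∑ v, w v := by
    rw [← Finset.sum_add_distrib]
    exact Finset.sum_congr rfl fun v _ => congr_fun (Set.indicator_self_add_compl S w) v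
  have hc0 : 0 ≤ ∑ v, Sᶜ.indicator w v :=
    Finset.sum_nonneg fun v _ => Set.indicator_nonneg (fun v _ => hw0 v) v
  have e : M.statePosterior m x S - 1 = -((∑ v, Sᶜ.indicator w v) / ∑ v, w v) := by
    change (∑ v, S.indicator w v) / (∑ v, w v) - 1 = _
    rw [← hsum] at hW0 ⊢
    field_simp
    ring
  rw [Real.dist_eq, e, abs_neg, abs_of_nonneg (div_nonneg hc0 hW0.le)]
  exact div_le_div_of_nonneg_left hc0 hv₀ hW

/-- Compare with one minimizer `v₀`, of weight at least of order `s ^ (-q)`; everything outside the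
set gains at least one more factor `1 / s`, and the common factor `D` cancels in the quotient. -/
theorem exists_dist_statePosterior_le (hG : 0 < G) {P : Fin G → Measure (Fin d → ℝ)}
    (hτ : ∀ (A : Node T) g, splitProb (P g) A ∈ Set.Ioo (0 : ℝ) 1)
    (hfeas : 0 < M.statePriorProb (M.feasible P)) {c : ℝ} (hc : 0 < c) (B : ℝ) :
    ∃ C > 0, ∀ s ≥ (1 : ℝ), ∀ (m : Fin G → ℕ) (x : Fin G → ℕ → Fin d → ℝ),
      (∀ g i, x g i ∈ unitBox d) →
      (∀ (A : Node T) g, TypicalCounts (splitProb (P g) A) c B s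
        (hitCount (x g) A.leftRegion (m g)) (hitCount (x g) (A.region \ A.leftRegion) (m g))) →
      dist (M.statePosterior m x (M.feasibleOfLeastComplexity P)) 1 ≤ C / s := by
  classical
  obtain ⟨v₀, hv₀F, hv₀, hleast⟩ := M.exists_isLeast_complexity hfeas
  set q := M.complexity v₀ with hq
  choose κ hκ Hκ using fun A => (M.prior A (v₀ A)).le_marginalRatio (hτ A) hc B (hv₀F A)
  -- An infeasible state may be given any decay rate; `q + 1` lets a single infeasible node settle
  -- the comparison.
  set e : Node T → Fin I → ℕ := fun A i =>
    if i ∈ M.feasibleStates P A then (M.prior A i).numParams else q + 1 with he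
  have hup : ∀ A i, ∃ C > 0, ∀ s ≥ (1 : ℝ), ∀ k r : Fin G → ℕ,
      (∀ g, TypicalCounts (splitProb (P g) A) c B s (k g) (r g)) →
      (M.prior A i).marginalRatio (fun g => splitProb (P g) A) k r ≤ C / s ^ e A i := by
    intro A i
    by_cases h : i ∈ M.feasibleStates P A
    · simp only [he, if_pos h]
      exact (M.prior A i).marginalRatio_le hG (hτ A) hc B h
    · simp only [he, if_neg h]
      exact (M.prior A i).marginalRatio_le_of_notMem_support (hτ A) hc B h _
  choose C hC HC using hup
  have hexp : ∀ v, v ∉ M.feasibleOfLeastComplexity P → 0 < M.stateProb v →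
      q + 1 ≤ ∑ A, e A (v A) := by
    intro v hv hpos
    by_cases hF : v ∈ M.feasible P
    · have e1 : ∑ A, e A (v A) = M.complexity v :=
        Finset.sum_congr rfl fun A _ => if_pos (hF A)
      rw [e1]
      have h1 : q ≤ M.complexity v := hleast.2 ⟨v, ⟨hF, hpos⟩, rfl⟩
      -- Complexities are integers, so exceeding the minimum `q` means being at least `q + 1`.
      refine lt_of_le_of_ne h1 fun h2 => hv ⟨hF, ?_⟩
      change IsLeast _ (M.complexity v)
      rwa [← h2]
    · obtain ⟨A, hA⟩ : ∃ A, v A ∉ M.feasibleStates P A := by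
        by_contra! h
        exact hF h
      have e1 : e A (v A) = q + 1 := if_neg hA
      rw [← e1]
      exact Finset.single_le_sum (f := fun A => e A (v A)) (fun _ _ => Nat.zero_le _)
        (Finset.mem_univ A)
  set C₁ := ∑ v, M.stateProb v * ∏ A, C A (v A) with hC₁
  set κ₀ := M.stateProb v₀ * ∏ A, κ A with hκ₀
  have hκ0 : 0 < κ₀ := mul_pos hv₀ (Finset.prod_pos fun A _ => hκ A)
  have hC0 : 0 < C₁ := Finset.sum_pos'
    (fun v _ => mul_nonneg (M.stateProb_nonneg v) (Finset.prod_pos fun A _ => hC A _).le)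
    ⟨v₀, Finset.mem_univ _, mul_pos hv₀ (Finset.prod_pos fun A _ => hC A _)⟩
  refine ⟨C₁ / κ₀, by positivity, fun s hs m x hx htyp => ?_⟩
  have hs0 : 0 < s := by linarith
  obtain ⟨D, hD, HD⟩ := M.exists_likelihood_eq_mul_prod hτ m hx
  set R : (A : Node T) → Fin I → ℝ := fun A i =>
    (M.prior A i).marginalRatio (fun g => splitProb (P g) A)
      (fun g => hitCount (x g) A.leftRegion (m g))
      (fun g => hitCount (x g) (A.region \ A.leftRegion) (m g)) with hR
  have hL : ∀ v, M.likelihood m x v = D * ∏ A, R A (v A) := HD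
  have hR0 : ∀ A i, 0 ≤ R A i := fun A i => NodePrior.marginalRatio_nonneg _ (hτ A) _ _
  have hlow : κ₀ * D / s ^ q ≤ M.stateProb v₀ * M.likelihood m x v₀ := by
    have h1 : ∏ A, κ A / s ^ (M.prior A (v₀ A)).numParams ≤ ∏ A, R A (v₀ A) :=
      Finset.prod_le_prod (fun A _ => (div_pos (hκ A) (pow_pos hs0 _)).le)
        fun A _ => Hκ A s hs _ _ (htyp A)
    rw [Finset.prod_div_distrib, Finset.prod_pow_eq_pow_sum] at h1
    rw [hL]
    calc κ₀ * D / s ^ q = M.stateProb v₀ * (D * ((∏ A, κ A) / s ^ q)) := by rw [hκ₀]; ring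
      _ ≤ _ := by
        refine mul_le_mul_of_nonneg_left (mul_le_mul_of_nonneg_left h1 hD.le) hv₀.le
  have hsum : ∑ v, (M.feasibleOfLeastComplexity P)ᶜ.indicator
      (fun w => M.stateProb w * M.likelihood m x w) v ≤ C₁ * D / s ^ (q + 1) := by
    rw [hC₁, Finset.sum_mul, Finset.sum_div]
    refine Finset.sum_le_sum fun v _ => ?_
    have hCv : 0 ≤ ∏ A, C A (v A) := (Finset.prod_pos fun A _ => hC A _).le
    have hnn : 0 ≤ M.stateProb v * (∏ A, C A (v A)) * D / s ^ (q + 1) :=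
      div_nonneg (mul_nonneg (mul_nonneg (M.stateProb_nonneg v) hCv) hD.le) (pow_pos hs0 _).le
    by_cases hv : v ∈ M.feasibleOfLeastComplexity P
    · rwa [Set.indicator_of_notMem (Set.notMem_compl_iff.2 hv)]
    rw [Set.indicator_of_mem (Set.mem_compl hv)]
    -- Configurations of prior probability zero carry no weight, even if their complexity is below
    -- `q`.
    rcases (M.stateProb_nonneg v).eq_or_lt with h0 | hpos
    · simp only [← h0]; simp
    · have h1 : ∏ A, R A (v A) ≤ ∏ A, C A (v A) / s ^ e A (v A) :=
        Finset.prod_le_prod (fun A _ => hR0 _ _) fun A _ => HC A _ s hs _ _ (htyp A)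
      rw [Finset.prod_div_distrib, Finset.prod_pow_eq_pow_sum] at h1
      have h2 : (∏ A, C A (v A)) / s ^ (∑ A, e A (v A)) ≤ (∏ A, C A (v A)) / s ^ (q + 1) :=
        div_le_div_of_nonneg_left hCv (pow_pos hs0 _) (pow_le_pow_right₀ hs (hexp v hv hpos))
      rw [hL]
      calc _ ≤ M.stateProb v * (D * ((∏ A, C A (v A)) / s ^ (q + 1))) :=
            mul_le_mul_of_nonneg_left (mul_le_mul_of_nonneg_left (h1.trans h2) hD.le) hpos.le
        _ = _ := by ring
  have hlow0 : 0 < κ₀ * D / s ^ q := by positivity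
  refine (M.dist_statePosterior_one_le m x _
    (fun v => by rw [hL]; exact mul_nonneg hD.le (Finset.prod_nonneg fun A _ => hR0 _ _))
    (v₀ := v₀) (hlow0.trans_le hlow)).trans ?_
  calc _ ≤ C₁ * D / s ^ (q + 1) / (κ₀ * D / s ^ q) :=
        div_le_div₀ (by positivity) hsum hlow0 hlow
    _ = C₁ / κ₀ / s := by
        rw [pow_succ]
        field_simp

end Model

/-! ### Typical counts at all nodes simultaneously. -/

/-- With high probability the counts of all nodes are typical. -/
theorem eventually_measureReal_not_typicalCounts_le {d G : ℕ} (T : PTree d)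
    {P : Fin G → Measure (Fin d → ℝ)} [∀ g, IsProbabilityMeasure (P g)]
    (hτ : ∀ (A : Node T) g, 0 < (P g).real A.region ∧ splitProb (P g) A ∈ Set.Ioo (0 : ℝ) 1)
    {N : ℕ → Fin G → ℕ} (hN : ∀ n, ∑ g, N n g = n) {ζ : Fin G → ℝ} (hζ : ∀ g, 0 < ζ g)
    (hNζ : ∀ g, Tendsto (fun n => (N n g : ℝ) / n) atTop (nhds (ζ g)))
    {S : Type*} [MeasurableSpace S] {ν : Measure S} [IsProbabilityMeasure ν]
    {X : Fin G → ℕ → S → Fin d → ℝ}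
    (hXind : iIndepFun (fun k : Fin G × ℕ => X k.1 k.2) ν)
    (hXlaw : ∀ g i, HasLaw (X g i) (P g) ν) :
    ∃ c > 0, ∀ η > 0, ∃ B : ℝ, ∀ᶠ n in atTop,
      ν.real {ω | ¬ ∀ (A : Node T) g, TypicalCounts (splitProb (P g) A) c B √(n : ℕ)
        (hitCount (fun i => X g i ω) A.leftRegion (N n g))
        (hitCount (fun i => X g i ω) (A.region \ A.leftRegion) (N n g))} ≤ η := by
  -- Eventually `N n g ≥ ζ g * n / 2`, so the expected count of a node is at least `2 * c * n`: one
  -- half is the required lower bound, the other covers the fluctuation `b * √n ≤ c * n`.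
  obtain ⟨c, hc, hcle⟩ := exists_pos_forall_le (f := fun p : Node T × Fin G =>
    ζ p.2 * (P p.2).real p.1.region / 4) fun p => by
      have := hζ p.2
      have := (hτ p.1 p.2).1
      positivity
  refine ⟨c, hc, fun η hη => ?_⟩
  set k := (Fintype.card (Node T × Fin G) : ℝ) with hk
  have hk0 : 0 ≤ k := Nat.cast_nonneg _
  -- The union bound runs over `2 * k` events of probability at most `1 / b ^ 2`; the `+ 1` keeps
  -- `b` positive when the tree has no non-terminal node.
  set b := √((2 * k + 1) / η) with hb
  have hb0 : 0 < b := Real.sqrt_pos.2 (by positivity)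
  have hbη : k * (1 / b ^ 2 + 1 / b ^ 2) ≤ η := by
    rw [hb, Real.sq_sqrt (by positivity), one_div_div]
    have : k * (η / (2 * k + 1) + η / (2 * k + 1)) = η * (2 * k / (2 * k + 1)) := by ring
    rw [this]
    exact mul_le_of_le_one_right hη.le ((div_le_one (by positivity)).2 (by linarith))
  refine ⟨2 * b, ?_⟩
  have hNev : ∀ᶠ n : ℕ in atTop, ∀ g, ζ g / 2 < (N n g : ℝ) / n :=
    eventually_all.2 fun g => (hNζ g).eventually_const_lt (half_lt_self (hζ g))
  have hsq : ∀ᶠ n : ℕ in atTop, b / c ≤ √(n : ℝ) :=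
    (Real.tendsto_sqrt_atTop.comp tendsto_natCast_atTop_atTop).eventually_ge_atTop _
  filter_upwards [hNev, hsq, eventually_gt_atTop 0] with n hn hns hn0
  have hn0' : (0 : ℝ) < n := by exact_mod_cast hn0
  have hNle : ∀ g, N n g ≤ n := fun g => by
    conv_rhs => rw [← hN n]
    exact Finset.single_le_sum (f := N n) (fun _ _ => Nat.zero_le _) (Finset.mem_univ g)
  set bad : Fin G → Set (Fin d → ℝ) → Set S := fun g s =>
    {ω | b * √n < |(hitCount (fun i => X g i ω) s (N n g) : ℝ) - N n g * (P g).real s|} with hbad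
  have hpair : ∀ g, Pairwise fun i j => X g i ⟂ᵢ[ν] X g j := fun g i j hij =>
    hXind.indepFun (i := (g, i)) (j := (g, j)) (by simpa using hij)
  have hbadle : ∀ g s, MeasurableSet s → ν.real (bad g s) ≤ 1 / b ^ 2 := fun g s hs =>
    measureReal_lt_abs_hitCount_sub_le (hpair g) (hXlaw g) hs (hNle g) hn0 hb0
  have hsub : {ω | ¬ ∀ (A : Node T) g, TypicalCounts (splitProb (P g) A) c (2 * b) √(n : ℕ)
        (hitCount (fun i => X g i ω) A.leftRegion (N n g))
        (hitCount (fun i => X g i ω) (A.region \ A.leftRegion) (N n g))} ⊆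
      ⋃ p : Node T × Fin G, bad p.2 p.1.region ∪ bad p.2 p.1.leftRegion := by
    intro ω hω
    by_contra h
    refine hω fun A g => ?_
    have h' : ω ∉ bad g A.region ∧ ω ∉ bad g A.leftRegion := by
      rw [Set.mem_iUnion, not_exists] at h
      have := h (A, g)
      rwa [Set.mem_union, not_or] at this
    refine typicalCounts_of_abs_sub_le (hτ A g).1 (hτ A g).2 (hNle g) ?_
      (not_lt.1 h'.1) (not_lt.1 h'.2)
    have h1 := (lt_div_iff₀ hn0').1 (hn g)
    have h2 := hcle (A, g)
    have h3 : b * √n ≤ c * n := by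
      rw [div_le_iff₀ hc] at hns
      calc b * √n ≤ √n * c * √n := by gcongr
        _ = c * (√n * √n) := by ring
        _ = c * n := by rw [Real.mul_self_sqrt hn0'.le]
    have h4 := mul_le_mul_of_nonneg_right h1.le (hτ A g).1.le
    have h5 := mul_le_mul_of_nonneg_right h2 hn0'.le
    simp only at h5
    linarith
  calc _ ≤ ν.real (⋃ p : Node T × Fin G, bad p.2 p.1.region ∪ bad p.2 p.1.leftRegion) :=
        measureReal_mono hsub
    _ ≤ ∑ p : Node T × Fin G, ν.real (bad p.2 p.1.region ∪ bad p.2 p.1.leftRegion) :=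
        measureReal_iUnion_fintype_le _
    _ ≤ ∑ _p : Node T × Fin G, (1 / b ^ 2 + 1 / b ^ 2) := by
        refine Finset.sum_le_sum fun p _ => (measureReal_union_le _ _).trans ?_
        exact add_le_add (hbadle _ _ (measurableSet_region _))
          (hbadle _ _ (measurableSet_leftRegion _))
    _ = k * (1 / b ^ 2 + 1 / b ^ 2) := by
        rw [Finset.sum_const, nsmul_eq_mul, Finset.card_univ]
    _ ≤ η := hbη

end PolyaTree

end

/-! ### Convergence in probability. -/

/-- The conditional posterior of the states given the tree concentrates, in probability, on the
feasible configurations of minimal complexity (minimal among the possible realizations). -/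
theorem theorem2 {d G I K : ℕ} (T : PolyaTree.PTree d) (hT : T ∈ PolyaTree.PTree.ofMaxDepth d K)
    (M : PolyaTree.Model T G I)
    -- the true sampling distributions on `(0,1]^d`
    (P : Fin G → Measure (Fin d → ℝ)) [∀ g, IsProbabilityMeasure (P g)]
    (hP : ∀ g, P g ≪ volume.restrict (PolyaTree.unitBox d : Set (Fin d → ℝ)))
    (hp : ∀ g, ∀ᵐ x ∂(volume.restrict (PolyaTree.unitBox d : Set (Fin d → ℝ))),
      0 < (P g).rnDeriv (volume.restrict (PolyaTree.unitBox d : Set (Fin d → ℝ))) x)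
    -- the sample sizes of the groups when the total sample size is `n`
    (N : ℕ → Fin G → ℕ) (hN : ∀ n, ∑ g, N n g = n)
    (ζ : Fin G → ℝ) (hζ : ∀ g, ζ g ∈ Set.Ioc (0 : ℝ) 1)
    (hNζ : ∀ g, Tendsto (fun n => (N n g : ℝ) / n) atTop (nhds (ζ g)))
    -- the prior gives positive probability to the feasible configurations
    (hfeas : 0 < M.statePriorProb (M.feasible P))
    -- the observations: independent, those of group `g` with law `P g`
    {S : Type*} [MeasurableSpace S] (ν : Measure S) [IsProbabilityMeasure ν]
    (X : Fin G → ℕ → S → Fin d → ℝ)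
    (hXind : iIndepFun (fun k : Fin G × ℕ => X k.1 k.2) ν)
    (hXlaw : ∀ g i, HasLaw (X g i) (P g) ν) :
    TendstoInMeasure ν
      (fun n ω => M.statePosterior (N n) (fun g i => X g i ω)
        (M.feasible P ∩
          {v | IsLeast (M.complexity '' (M.feasible P ∩ M.possible)) (M.complexity v)}))
      atTop (fun _ => 1) := by
  have hG : 0 < G := by
    rcases Nat.eq_zero_or_pos G with rfl | h
    · have := hN 1
      simp at this
    · exact h
  have hτ := fun (A : PolyaTree.Node T) g => PolyaTree.splitProb_mem_Ioo (hP g) (hp g) A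
  obtain ⟨c, hc, H⟩ := PolyaTree.eventually_measureReal_not_typicalCounts_le T hτ hN
    (fun g => (hζ g).1) hNζ hXind hXlaw
  -- The likelihood factorizes only for data in the unit box, since the density vanishes outside;
  -- this holds almost surely.
  have hbox : ∀ᵐ ω ∂ν, ∀ g i, X g i ω ∈ PolyaTree.unitBox d := by
    refine ae_all_iff.2 fun g => ae_all_iff.2 fun i => ?_
    have h1 : ∀ᵐ x ∂(P g), x ∈ (PolyaTree.unitBox d : Set (Fin d → ℝ)) :=
      (hP g).ae_le (ae_restrict_mem (PolyaTree.unitBox d).measurableSet_coe)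
    rw [← (hXlaw g i).map_eq] at h1
    exact ae_of_ae_map (hXlaw g i).aemeasurable h1
  rw [tendstoInMeasure_iff_measureReal_dist]
  intro ε hε
  refine Metric.tendsto_nhds.2 fun η hη => ?_
  obtain ⟨B, HB⟩ := H (η / 2) (half_pos hη)
  obtain ⟨C, hC, HC⟩ := M.exists_dist_statePosterior_le hG (fun A g => (hτ A g).2) hfeas hc B
  -- The `+ 1` ensures both `√n ≥ 1` and the strict inequality `C / √n < ε`.
  have hsq : ∀ᶠ n : ℕ in atTop, C / ε + 1 ≤ √(n : ℝ) :=
    (Real.tendsto_sqrt_atTop.comp tendsto_natCast_atTop_atTop).eventually_ge_atTop _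
  filter_upwards [HB, hsq] with n hn hns
  have hCε : 0 < C / ε := by positivity
  have hlt : C / √(n : ℝ) < ε := by
    rw [div_lt_comm₀ (by linarith) hε]
    linarith
  rw [Real.dist_eq, sub_zero, abs_of_nonneg measureReal_nonneg]
  refine lt_of_le_of_lt ?_ (half_lt_self hη)
  -- Up to a null set, a posterior at distance at least `ε` from one forces atypical counts.
  refine le_trans (ENNReal.toReal_mono (measure_ne_top _ _) (measure_mono_ae ?_)) hn
  filter_upwards [hbox] with ω hω hdist htyp
  exact (HC _ (by linarith) (N n) (fun g i => X g i ω) hω htyp).not_gt (hlt.trans_le hdist)
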